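/- Let $G=(V,E)$ be a finite undirected graph (loops and multiple edges allowed) and let $A,B\subseteq V^2$. A *fourientation* $\phi$ of $G$ gives each edge (including loops) one of four configurations: 0-way (not traversable), 1-way (traversable in only one of its two directions), or 2-way (traversable in both directions). The *solid* edges of $\phi$ are the 0-way and the 2-way edges. Let $\vec G(A,B;\phi)$ be the digraph on $V$ whose arcs are the permitted traversals of the edges in $\phi$ together with the pairs in $A$ and $B$ as additional arcs. The fourientation $\phi$ is *$(A,B)$-valid* if in $\vec G(A,B;\phi)$ the vertex $v$ cannot reach $u$ by a directed path for all $(u,v)\in A$, and $v$ can reach $u$ for all $(u,v)\in B$ (paths of length $0$ are allowed). A *directed cycle* of $\phi$ is a cycle of $G$ that can be traversed in one direction using only traversals permitted by $\phi$. An *$(A,B)$-cocycle* is a non-empty set of edges of the form $\{e\in E: e \text{ has one end in } V_1 \text{ and the other in } V_2\}$ for a partition $V=V_1\sqcup V_2$ such that no pair in $A\cup B$ has one element in $V_1$ and the other in $V_2$; it is *directed* in $\phi$ if, for some such partition defining it, no edge can be traversed from $V_2$ to $V_1$ in $\phi$. Reversing a directed cycle (resp. directed $(A,B)$-cocycle)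 of $\phi$ means reversing all the 1-way edges in it and leaving all other edges unchanged. Two fourientations are *cycle equivalent* (resp. *cocycle equivalent*, *cycle-cocycle equivalent*) if one can be obtained from the other by repeatedly reversing directed cycles (resp. directed $(A,B)$-cocycles, directed cycles and/or directed $(A,B)$-cocycles). For $S\subseteq E$, let - $\mathrm{Four}_{G,S}(A,B)/\mathrm{cyc}$ be the set of cycle equivalence classes of $(A,B)$-valid fourientations with set of solid edges $S$ that contain no cycle of $G$ made entirely of 2-way edges; - $\mathrm{Four}_{G,S}(A,B)/\mathrm{coc}$ be the set of cocycle equivalence classes of $(A,B)$-valid fourientations with set of solid edges $S$ that contain no $(A,B)$-cocycle made entirely of 0-way edges; - $\mathrm{Four}_{G,S}(A,B)/\mathrm{cc}$ be the set of cycle-cocycle equivalence classes of $(A,B)$-valid fourientations with set of solid edges $S$ that contain neither a cycle of $G$ made entirely of 2-way edges nor an $(A,B)$-cocycle made entirely of 0-way edges. Then: (i) $|\mathrm{Four}_{G,S}(A,B)/\mathrm{cyc}|$ is independent of $S\subseteq E$; (ii) $|\mathrm{Four}_{G,S}(A,B)/\mathrm{coc}|$ is independent of $S\subseteq E$; (iii)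 $|\mathrm{Four}_{G,S}(A,B)/\mathrm{cc}|$ is independent of $S\subseteq E$. -/

import Mathlib

open scoped Graph

namespace Fourient

variable {α β : Type*}

/-- A conventional orientation of a multigraph (loops and multiple edges are allowed): every
edge `e` gets a conventional direction, from `tail e` to `head e`. -/
structure RefOrientation (G : Graph α β) where
  tail : E(G) → V(G)
  head : E(G) → V(G)
  isLink : ∀ e : E(G), G.IsLink e (tail e) (head e)

/-- The four configurations of an edge: not traversable, traversable only in the conventional
direction, only in the opposite direction, or in both directions. -/
inductive Config
  | zeroWay
  | forward
  | backward
  | twoWay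
  deriving DecidableEq

/-- `c.Allows d`: an edge with configuration `c` can be traversed in the conventional direction
(`d = true`), resp. in the opposite direction (`d = false`). -/
def Config.Allows : Config → Bool → Prop
  | .zeroWay, _ => False
  | .forward, d => d = true
  | .backward, d => d = false
  | .twoWay, _ => True

/-- Reversing an edge swaps the two 1-way configurations and keeps the 0-way and 2-way ones. -/
def Config.reverse : Config → Config
  | .zeroWay => .zeroWay
  | .forward => .backward
  | .backward => .forward
  | .twoWay => .twoWay

/-- A fourientation assigns one of four configurations to each edge (loops included). -/
abbrev Fourientation (G : Graph α β) := E(G) → Config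

/-- The arcs of the digraph in which each edge is replaced by two opposite arcs: `(e, true)` is
`e` in its conventional direction and `(e, false)` is `e` in the opposite direction. -/
abbrev Arc (G : Graph α β) := E(G) × Bool

variable {G : Graph α β}

namespace RefOrientation

/-- Initial vertex of an arc. -/
def src (D : RefOrientation G) (a : Arc G) : V(G) := if a.2 then D.tail a.1 else D.head a.1

/-- Terminal vertex of an arc. -/
def tgt (D : RefOrientation G) (a : Arc G) : V(G) := if a.2 then D.head a.1 else D.tail a.1

/-- Adjacency in the digraph obtained from the digraph of `φ` by adding the arcs in `A` and
`B`. -/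
def Adj (D : RefOrientation G) (A B : Set (V(G) × V(G))) (φ : Fourientation G)
    (u v : V(G)) : Prop :=
  (∃ a : Arc G, (φ a.1).Allows a.2 ∧ D.src a = u ∧ D.tgt a = v) ∨ (u, v) ∈ A ∨ (u, v) ∈ B

/-- `u` can reach `v` by a directed path, in the digraph of `φ` with the arcs in `A` and `B`
added. -/
def Reach (D : RefOrientation G) (A B : Set (V(G) × V(G))) (φ : Fourientation G) :
    V(G) → V(G) → Prop :=
  Relation.ReflTransGen (D.Adj A B φ)

/-- `(A,B)`-valid fourientations. -/
def Valid (D : RefOrientation G) (A B : Set (V(G) × V(G))) (φ : Fourientation G) : Prop :=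
  (∀ u v, (u, v) ∈ A → ¬ D.Reach A B φ v u) ∧ (∀ u v, (u, v) ∈ B → D.Reach A B φ v u)

end RefOrientation

/-- The solid edges of a fourientation: the 0-way and the 2-way ones. -/
def solid (φ : Fourientation G) : Set E(G) := {e | φ e = .zeroWay ∨ φ e = .twoWay}

/-- Reverse all the 1-way edges in `F`; all other edges are left unchanged. -/
noncomputable def reverseOn (F : Set E(G)) (φ : Fourientation G) : Fourientation G :=
  open Classical in fun e => if e ∈ F then (φ e).reverse else φ e

namespace RefOrientation

/-- A cycle of the graph (with a direction of traversal): arcs `c 0, …, c k`, each ending where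
the next one starts and `c k` ending where `c 0` starts (addition in `Fin (k + 1)` is cyclic),
without repeated vertices or edges. A loop is a cycle of length one, and two parallel edges
form a cycle of length two. -/
structure IsCycle (D : RefOrientation G) {k : ℕ} (c : Fin (k + 1) → Arc G) : Prop where
  closed : ∀ i, D.tgt (c i) = D.src (c (i + 1))
  vertices : Function.Injective fun i => D.src (c i)
  edges : Function.Injective fun i => (c i).1

/-- `ψ` is obtained from `φ` by reversing a directed cycle of `φ`. -/
def CycleStep (D : RefOrientation G) (φ ψ : Fourientation G) : Prop :=
  ∃ (k : ℕ) (c : Fin (k + 1) → Arc G), D.IsCycle c ∧ (∀ i, (φ (c i).1).Allows (c i).2) ∧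
    ψ = reverseOn (Set.range fun i => (c i).1) φ

/-- Some cycle of the graph is made entirely of 2-way edges of `φ`. -/
def HasTwoWayCycle (D : RefOrientation G) (φ : Fourientation G) : Prop :=
  ∃ (k : ℕ) (c : Fin (k + 1) → Arc G), D.IsCycle c ∧ ∀ i, φ (c i).1 = .twoWay

/-- The edges of the graph having one end in `U` and the other end outside of `U`. -/
def cut (D : RefOrientation G) (U : Set V(G)) : Set E(G) :=
  {e | ¬ (D.tail e ∈ U ↔ D.head e ∈ U)}

/-- The partition `(U, Uᶜ)` of the vertices defines a (non-empty) cocycle of the graph, and the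
arcs in `A ∪ B` do not cross it. -/
def IsABCut (D : RefOrientation G) (A B : Set (V(G) × V(G))) (U : Set V(G)) : Prop :=
  (D.cut U).Nonempty ∧ ∀ u v, (u, v) ∈ A ∪ B → (u ∈ U ↔ v ∈ U)

/-- `ψ` is obtained from `φ` by reversing a directed `(A,B)`-cocycle of `φ`: the cut of a
partition `(U, Uᶜ)` crossed by no arc in `A ∪ B`, such that no arc of `φ` goes from `Uᶜ`
to `U`. -/
def CocycleStep (D : RefOrientation G) (A B : Set (V(G) × V(G)))
    (φ ψ : Fourientation G) : Prop :=
  ∃ U : Set V(G), D.IsABCut A B U ∧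
    (∀ a : Arc G, (φ a.1).Allows a.2 → D.src a ∉ U → D.tgt a ∉ U) ∧
    ψ = reverseOn (D.cut U) φ

/-- Some `(A,B)`-cocycle is made entirely of 0-way edges of `φ`. -/
def HasZeroWayCocycle (D : RefOrientation G) (A B : Set (V(G) × V(G)))
    (φ : Fourientation G) : Prop :=
  ∃ U : Set V(G), D.IsABCut A B U ∧ ∀ e ∈ D.cut U, φ e = .zeroWay

/-- Cycle equivalence: reachability by repeated reversals of directed cycles. -/
def CycleEquiv (D : RefOrientation G) : Fourientation G → Fourientation G → Prop :=
  Relation.ReflTransGen D.CycleStep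

/-- Cocycle equivalence: reachability by repeated reversals of directed `(A,B)`-cocycles. -/
def CocycleEquiv (D : RefOrientation G) (A B : Set (V(G) × V(G))) :
    Fourientation G → Fourientation G → Prop :=
  Relation.ReflTransGen (D.CocycleStep A B)

/-- Cycle-cocycle equivalence: reachability by repeated reversals of directed cycles and/or
directed `(A,B)`-cocycles. -/
def CycleCocycleEquiv (D : RefOrientation G) (A B : Set (V(G) × V(G))) :
    Fourientation G → Fourientation G → Prop :=
  Relation.ReflTransGen fun φ ψ => D.CycleStep φ ψ ∨ D.CocycleStep A B φ ψ

/-- `(A,B)`-valid fourientations with set of solid edges `S`. -/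
def four (D : RefOrientation G) (A B : Set (V(G) × V(G))) (S : Set E(G)) :
    Set (Fourientation G) :=
  {φ | D.Valid A B φ ∧ solid φ = S}

/-- The cycle equivalence classes of `(A,B)`-valid fourientations with solid set `S` containing
no cycle made entirely of 2-way edges. -/
def cycClasses (D : RefOrientation G) (A B : Set (V(G) × V(G))) (S : Set E(G)) :
    Set (Set (Fourientation G)) :=
  {C | (∃ φ, C = {ψ | D.CycleEquiv φ ψ}) ∧
    ∀ φ ∈ C, φ ∈ D.four A B S ∧ ¬ D.HasTwoWayCycle φ}

/-- The cocycle equivalence classes of `(A,B)`-valid fourientations with solid set `S`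
containing no `(A,B)`-cocycle made entirely of 0-way edges. -/
def cocClasses (D : RefOrientation G) (A B : Set (V(G) × V(G))) (S : Set E(G)) :
    Set (Set (Fourientation G)) :=
  {C | (∃ φ, C = {ψ | D.CocycleEquiv A B φ ψ}) ∧
    ∀ φ ∈ C, φ ∈ D.four A B S ∧ ¬ D.HasZeroWayCocycle A B φ}

/-- The cycle-cocycle equivalence classes of `(A,B)`-valid fourientations with solid set `S`
containing no cycle made entirely of 2-way edges and no `(A,B)`-cocycle made entirely of 0-way
edges. -/
def ccClasses (D : RefOrientation G) (A B : Set (V(G) × V(G))) (S : Set E(G)) :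
    Set (Set (Fourientation G)) :=
  {C | (∃ φ, C = {ψ | D.CycleCocycleEquiv A B φ ψ}) ∧
    ∀ φ ∈ C, φ ∈ D.four A B S ∧ ¬ D.HasTwoWayCycle φ ∧ ¬ D.HasZeroWayCocycle A B φ}

end RefOrientation

end Fourient

/-! Each quotient is replaced by a set of canonical representatives, and the representatives are
counted by toggling one edge at a time.

Cycle classes: for an injective ranking of the edges, a class has exactly one member in which every
directed cycle has its least-ranked 1-way edge in the conventional direction (`Compat`). A
lexicographically largest sign vector gives existence. For uniqueness, two members of a class differ
by a flow, and the least edge where they differ would produce a cut with non-zero flux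
(`Compat.eq_of_flux`).

Cocycle classes: fix a root in each component of the graph with `A ∪ B` added. A class has exactly
one member in which every root reaches its whole component (`Rooted`). Enlarging the reached set by
reversing cuts gives existence; two members differ by a potential, and a maximum principle makes it
constant on components (`Differ.le_root`). Combining both conditions represents the cycle-cocycle
classes. `Rooted` is itself a validity condition, for a larger set of arcs, so it needs no toggling
argument of its own.

Toggling: freeze everything except `e`. If the tail of `e` reaches its head without `e`, traversing
`e` forward adds no reachability, so forward behaves like 0-way and backward like 2-way. If the head
reaches the tail, the roles are exchanged; if neither holds, validity does not depend on `e`. When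
`e` has the largest rank, `Compat` follows the same pairing (`exists_pairs_valid_compat`).
Exchanging paired configurations is an involution that moves `e` into or out of the solid set
(`ncard_solid_insert`). The class counts do not involve the ranking, so it may be chosen anew for
each `e`. -/

namespace Fourient

open Relation

variable {α β : Type*} {G : Graph α β}

/-! ### Toggling one edge -/

/-- Reachability after adding (some of) two opposite arcs to a relation. -/
theorem reflTransGen_add_edge {V : Type*} {r r' : V → V → Prop} {x y : V} {p n : Prop}
    (h : ∀ u v, r' u v ↔ r u v ∨ (p ∧ u = x ∧ v = y) ∨ (n ∧ u = y ∧ v = x)) (a b : V) :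
    ReflTransGen r' a b ↔ ReflTransGen r a b ∨
      (p ∧ ReflTransGen r a x ∧ ReflTransGen r y b) ∨
      (n ∧ ReflTransGen r a y ∧ ReflTransGen r x b) := by
  constructor
  · intro hab
    induction hab with
    | refl => exact .inl .refl
    | tail _ hs ih =>
      rcases (h _ _).1 hs with hs | ⟨hp, rfl, rfl⟩ | ⟨hn, rfl, rfl⟩
      · rcases ih with ih | ⟨hp, h1, h2⟩ | ⟨hn, h1, h2⟩
        · exact .inl (ih.tail hs)
        · exact .inr (.inl ⟨hp, h1, h2.tail hs⟩)
        · exact .inr (.inr ⟨hn, h1, h2.tail hs⟩)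
      · rcases ih with ih | ⟨_, h1, _⟩ | ⟨_, h1, _⟩
        · exact .inr (.inl ⟨hp, ih, .refl⟩)
        · exact .inr (.inl ⟨hp, h1, .refl⟩)
        -- This walk went through `y` before taking `y → x`, so returning along `x → y` is a detour
        -- that can be cut out.
        · exact .inl h1
      · rcases ih with ih | ⟨_, h1, _⟩ | ⟨_, h1, _⟩
        · exact .inr (.inr ⟨hn, ih, .refl⟩)
        · exact .inl h1
        · exact .inr (.inr ⟨hn, h1, .refl⟩)
  · have hmono : ∀ {a b}, ReflTransGen r a b → ReflTransGen r' a b :=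
      ReflTransGen.mono (fun u v huv => (h u v).2 (.inl huv)) _ _
    rintro (hab | ⟨hp, h1, h2⟩ | ⟨hn, h1, h2⟩)
    · exact hmono hab
    · exact ((hmono h1).tail ((h x y).2 (.inr (.inl ⟨hp, rfl, rfl⟩)))).trans (hmono h2)
    · exact ((hmono h1).tail ((h y x).2 (.inr (.inr ⟨hn, rfl, rfl⟩)))).trans (hmono h2)

namespace RefOrientation

variable (D : RefOrientation G)

@[simp] theorem src_true (e : E(G)) : D.src (e, true) = D.tail e := rfl
@[simp] theorem src_false (e : E(G)) : D.src (e, false) = D.head e := rfl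
@[simp] theorem tgt_true (e : E(G)) : D.tgt (e, true) = D.head e := rfl
@[simp] theorem tgt_false (e : E(G)) : D.tgt (e, false) = D.tail e := rfl

/-- Adjacency through the arcs in `T`. -/
def ArcRel (T : Set (Arc G)) (u v : V(G)) : Prop := ∃ a ∈ T, D.src a = u ∧ D.tgt a = v

variable {D}

theorem arcRel_add_edge {T T' : Set (Arc G)} {e : E(G)} {p n : Prop}
    (hne : ∀ a : Arc G, a.1 ≠ e → (a ∈ T' ↔ a ∈ T)) (he : ∀ d, (e, d) ∉ T)
    (hp : (e, true) ∈ T' ↔ p) (hn : (e, false) ∈ T' ↔ n) (u v : V(G)) :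
    D.ArcRel T' u v ↔ D.ArcRel T u v ∨ (p ∧ u = D.tail e ∧ v = D.head e) ∨
      (n ∧ u = D.head e ∧ v = D.tail e) := by
  constructor
  · rintro ⟨⟨e', d⟩, ha, rfl, rfl⟩
    by_cases h : e' = e
    · subst h
      cases d
      · exact .inr (.inr ⟨hn.1 ha, rfl, rfl⟩)
      · exact .inr (.inl ⟨hp.1 ha, rfl, rfl⟩)
    · exact .inl ⟨_, (hne (e', d) h).1 ha, rfl, rfl⟩
  · rintro (⟨⟨e', d⟩, ha, rfl, rfl⟩ | ⟨h, rfl, rfl⟩ | ⟨h, rfl, rfl⟩)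
    · have h : e' ≠ e := by
        rintro rfl
        exact he _ ha
      exact ⟨_, (hne (e', d) h).2 ha, rfl, rfl⟩
    · exact ⟨_, hp.2 h, rfl, rfl⟩
    · exact ⟨_, hn.2 h, rfl, rfl⟩

theorem adj_iff {A B : Set (V(G) × V(G))} {φ : Fourientation G} {u v : V(G)} :
    D.Adj A B φ u v ↔ D.ArcRel {a | (φ a.1).Allows a.2} u v ∨ (u, v) ∈ A ∨ (u, v) ∈ B :=
  Iff.rfl

theorem reach_update [DecidableEq E(G)] {A B : Set (V(G) × V(G))} (φ : Fourientation G)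
    (e : E(G)) (c : Config) (a b : V(G)) :
    D.Reach A B (Function.update φ e c) a b ↔
      D.Reach A B (Function.update φ e .zeroWay) a b ∨
      (c.Allows true ∧ D.Reach A B (Function.update φ e .zeroWay) a (D.tail e) ∧
        D.Reach A B (Function.update φ e .zeroWay) (D.head e) b) ∨
      (c.Allows false ∧ D.Reach A B (Function.update φ e .zeroWay) a (D.head e) ∧
        D.Reach A B (Function.update φ e .zeroWay) (D.tail e) b) := by
  refine reflTransGen_add_edge (fun u v => ?_) a b
  rw [adj_iff, adj_iff, arcRel_add_edge (T := {a | (Function.update φ e .zeroWay a.1).Allows a.2})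
    (e := e) (p := c.Allows true) (n := c.Allows false)]
  · tauto
  · intro a ha
    simp [ha]
  · simp [Config.Allows]
  · simp
  · simp

section Toggle

variable {A B : Set (V(G) × V(G))} {φ : Fourientation G} {e : E(G)}

theorem Reach.mono {A' B' : Set (V(G) × V(G))} (hAB : A ∪ B ⊆ A' ∪ B') {u v : V(G)}
    (h : D.Reach A B φ u v) : D.Reach A' B' φ u v :=
  ReflTransGen.mono (fun _ _ => Or.imp_right fun h => hAB h) _ _ h

/-- The pairing of the two 1-way configurations with the two solid ones at the edge `e`. -/
def Pairs (P : Config → Prop) : Bool → Prop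
  | true => (P .forward ↔ P .zeroWay) ∧ (P .backward ↔ P .twoWay)
  | false => (P .forward ↔ P .twoWay) ∧ (P .backward ↔ P .zeroWay)

variable [DecidableEq E(G)]

/-- A forward traversal of `e` can be replaced by the walk avoiding `e`, so permitting it leaves the
reachability relation unchanged. -/
theorem valid_update_of_reach
    (h : D.Reach A B (Function.update φ e .zeroWay) (D.tail e) (D.head e)) :
    (D.Valid A B (Function.update φ e .forward) ↔ D.Valid A B (Function.update φ e .zeroWay)) ∧
    (D.Valid A B (Function.update φ e .backward) ↔
      D.Valid A B (Function.update φ e .twoWay)) := by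
  have hf : ∀ a b, D.Reach A B (Function.update φ e .forward) a b ↔
      D.Reach A B (Function.update φ e .zeroWay) a b := by
    intro a b
    rw [reach_update φ e .forward]
    simp only [Config.Allows, true_and, Bool.false_eq_true, false_and, or_false,
      or_iff_left_iff_imp]
    exact fun ⟨h1, h2⟩ => (h1.trans h).trans h2
  have hb : ∀ a b, D.Reach A B (Function.update φ e .backward) a b ↔
      D.Reach A B (Function.update φ e .twoWay) a b := by
    intro a b
    rw [reach_update φ e .backward, reach_update φ e .twoWay]
    simp only [Config.Allows, true_and, Bool.true_eq_false, false_and, false_or]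
    constructor
    · tauto
    · rintro (h1 | ⟨h1, h2⟩ | h1)
      · exact .inl h1
      · exact .inl ((h1.trans h).trans h2)
      · exact .inr h1
  simp only [Valid, hf, hb, and_self]

theorem valid_update_of_reach_symm
    (h : D.Reach A B (Function.update φ e .zeroWay) (D.head e) (D.tail e)) :
    (D.Valid A B (Function.update φ e .forward) ↔ D.Valid A B (Function.update φ e .twoWay)) ∧
    (D.Valid A B (Function.update φ e .backward) ↔
      D.Valid A B (Function.update φ e .zeroWay)) := by
  have hf : ∀ a b, D.Reach A B (Function.update φ e .backward) a b ↔
      D.Reach A B (Function.update φ e .zeroWay) a b := by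
    intro a b
    rw [reach_update φ e .backward]
    simp only [Config.Allows, true_and, Bool.true_eq_false, false_and, false_or,
      or_iff_left_iff_imp]
    exact fun ⟨h1, h2⟩ => (h1.trans h).trans h2
  have hb : ∀ a b, D.Reach A B (Function.update φ e .forward) a b ↔
      D.Reach A B (Function.update φ e .twoWay) a b := by
    intro a b
    rw [reach_update φ e .forward, reach_update φ e .twoWay]
    simp only [Config.Allows, true_and, Bool.false_eq_true, false_and, or_false]
    constructor
    · tauto
    · rintro (h1 | h1 | ⟨h1, h2⟩)
      · exact .inl h1
      · exact .inr h1
      · exact .inl ((h1.trans h).trans h2)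
  simp only [Valid, hf, hb, and_self]

/-- Validity only asks for walks from `v` to `u` where `u → v` is an arc. Such a walk through `e`
closes up along that arc, and the closed walk would join the ends of `e` without using `e`. -/
theorem valid_update_of_not_reach
    (h : ¬ D.Reach A B (Function.update φ e .zeroWay) (D.tail e) (D.head e))
    (h' : ¬ D.Reach A B (Function.update φ e .zeroWay) (D.head e) (D.tail e)) (c : Config) :
    D.Valid A B (Function.update φ e c) ↔ D.Valid A B (Function.update φ e .zeroWay) := by
  have key : ∀ u v, (u, v) ∈ A ∨ (u, v) ∈ B → (D.Reach A B (Function.update φ e c) v u ↔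
      D.Reach A B (Function.update φ e .zeroWay) v u) := by
    intro u v huv
    have hs : D.Reach A B (Function.update φ e .zeroWay) u v := .single (.inr huv)
    rw [reach_update φ e c, or_iff_left_iff_imp]
    rintro (⟨_, h1, h2⟩ | ⟨_, h1, h2⟩)
    · exact absurd ((h2.trans hs).trans h1) h'
    · exact absurd ((h2.trans hs).trans h1) h
  unfold Valid
  refine and_congr ?_ ?_
  · exact forall₂_congr fun u v => forall_congr' fun huv => not_congr (key u v (.inl huv))
  · exact forall₂_congr fun u v => forall_congr' fun huv => key u v (.inr huv)

/-- The inclusion keeps the two conditions from demanding opposite pairings: reachability for the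
smaller set of arcs implies it for the larger one. If the larger set connects the ends of `e` in
both directions, its condition accepts either pairing and the smaller set decides. If it connects
them in one direction only, the smaller set either agrees or is indifferent. -/
theorem exists_pairs_valid {A' B' : Set (V(G) × V(G))} (hAB : A ∪ B ⊆ A' ∪ B')
    (φ : Fourientation G) (e : E(G)) :
    ∃ b, Pairs (fun c => D.Valid A B (Function.update φ e c) ∧
      D.Valid A' B' (Function.update φ e c)) b := by
  by_cases h : D.Reach A' B' (Function.update φ e .zeroWay) (D.tail e) (D.head e)
  · by_cases h1 : D.Reach A' B' (Function.update φ e .zeroWay) (D.head e) (D.tail e)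
    · by_cases h2 : D.Reach A B (Function.update φ e .zeroWay) (D.tail e) (D.head e)
      · have := valid_update_of_reach h
        have := valid_update_of_reach h2
        exact ⟨true, by simp only [Pairs]; tauto⟩
      · by_cases h3 : D.Reach A B (Function.update φ e .zeroWay) (D.head e) (D.tail e)
        · have := valid_update_of_reach_symm h1
          have := valid_update_of_reach_symm h3
          exact ⟨false, by simp only [Pairs]; tauto⟩
        · have := valid_update_of_reach h
          have h4 := valid_update_of_not_reach h2 h3
          exact ⟨true, by simp only [Pairs, h4]; tauto⟩
    · have h3 := fun hr => h1 (Reach.mono hAB hr)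
      have := valid_update_of_reach h
      by_cases h2 : D.Reach A B (Function.update φ e .zeroWay) (D.tail e) (D.head e)
      · have := valid_update_of_reach h2
        exact ⟨true, by simp only [Pairs]; tauto⟩
      · have h4 := valid_update_of_not_reach h2 h3
        exact ⟨true, by simp only [Pairs, h4]; tauto⟩
  · have h2 := fun hr => h (Reach.mono hAB hr)
    by_cases h1 : D.Reach A' B' (Function.update φ e .zeroWay) (D.head e) (D.tail e)
    · have := valid_update_of_reach_symm h1
      by_cases h3 : D.Reach A B (Function.update φ e .zeroWay) (D.head e) (D.tail e)
      · have := valid_update_of_reach_symm h3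
        exact ⟨false, by simp only [Pairs]; tauto⟩
      · have h4 := valid_update_of_not_reach h2 h3
        exact ⟨false, by simp only [Pairs, h4]; tauto⟩
    · have h3 := fun hr => h1 (Reach.mono hAB hr)
      have h4 := valid_update_of_not_reach h2 h3
      have h5 := valid_update_of_not_reach h h1
      exact ⟨true, by simp only [Pairs, h4, h5, and_self]⟩

end Toggle

/-! ### Fourientations compatible with a ranking of the edges -/

/-- The arcs of the 2-way edges other than `m`. -/
def twoWayArcs (φ : Fourientation G) (m : E(G)) : Set (Arc G) := {a | φ a.1 = .twoWay ∧ a.1 ≠ m}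

/-- The arcs of the 2-way edges and the permitted arcs of rank larger than that of `m`. -/
def upperArcs (r : E(G) → ℕ) (φ : Fourientation G) (m : E(G)) : Set (Arc G) :=
  {a | φ a.1 = .twoWay ∨ ((φ a.1).Allows a.2 ∧ r m < r a.1)}

variable (D) in
/-- No cycle of `φ` is made of 2-way edges, and in each directed cycle of `φ` the 1-way edge of
least rank has its conventional direction. -/
def Compat (r : E(G) → ℕ) (φ : Fourientation G) : Prop :=
  (∀ m, φ m = .twoWay → ¬ ReflTransGen (D.ArcRel (twoWayArcs φ m)) (D.tail m) (D.head m)) ∧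
  ∀ m, φ m = .backward → ¬ ReflTransGen (D.ArcRel (upperArcs r φ m)) (D.tail m) (D.head m)

theorem reflTransGen_arcRel_symm {T : Set (Arc G)} (hT : ∀ e d, (e, d) ∈ T → (e, !d) ∈ T)
    {u v : V(G)} (h : ReflTransGen (D.ArcRel T) u v) : ReflTransGen (D.ArcRel T) v u := by
  induction h with
  | refl => exact .refl
  | tail _ hs ih =>
    obtain ⟨⟨e, d⟩, ha, rfl, rfl⟩ := hs
    refine ih.head ⟨(e, !d), hT e d ha, ?_⟩
    cases d <;> exact ⟨rfl, rfl⟩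

theorem twoWayArcs_symm (φ : Fourientation G) (m e : E(G)) (d : Bool)
    (h : (e, d) ∈ twoWayArcs φ m) : (e, !d) ∈ twoWayArcs φ m := h

theorem arcRel_mono {T T' : Set (Arc G)} (h : T ⊆ T') {u v : V(G)}
    (huv : ReflTransGen (D.ArcRel T) u v) : ReflTransGen (D.ArcRel T') u v :=
  ReflTransGen.mono (fun _ _ ⟨a, ha, h'⟩ => ⟨a, h ha, h'⟩) _ _ huv

/-! ### Compatibility when the edge of largest rank changes -/

section ToggleCompat

variable {r : E(G) → ℕ} {φ : Fourientation G} {e : E(G)}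

variable (D) in
/-- Some 1-way edge `m` with its unconventional direction is the 1-way edge of least rank on a
walk of `φ` from `y` to `x`. -/
def BadWalk (r : E(G) → ℕ) (φ : Fourientation G) (x y : V(G)) : Prop :=
  ∃ m, φ m = .backward ∧ ReflTransGen (D.ArcRel (upperArcs r φ m)) (D.tail m) x ∧
    ReflTransGen (D.ArcRel (upperArcs r φ m)) y (D.head m)

theorem upperArcs_anti {m m' : E(G)} (h : r m ≤ r m') : upperArcs r φ m' ⊆ upperArcs r φ m :=
  fun _ => Or.imp_right fun ha => ⟨ha.1, h.trans_lt ha.2⟩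

theorem twoWay_subset_upperArcs (m : E(G)) : {a : Arc G | φ a.1 = .twoWay} ⊆ upperArcs r φ m :=
  fun _ => Or.inl

theorem reach_of_upperArcs {A B : Set (V(G) × V(G))} {m : E(G)} {u v : V(G)}
    (h : ReflTransGen (D.ArcRel (upperArcs r φ m)) u v) : D.Reach A B φ u v := by
  refine ReflTransGen.mono ?_ _ _ h
  rintro u v ⟨a, ha, h⟩
  refine .inl ⟨a, ?_, h⟩
  rcases ha with ha | ha
  · rw [ha]
    trivial
  · exact ha.1

theorem BadWalk.reach {A B : Set (V(G) × V(G))} {x y : V(G)} (h : D.BadWalk r φ x y) :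
    D.Reach A B φ y x := by
  obtain ⟨m, hm, h1, h2⟩ := h
  have hs : D.Adj A B φ (D.head m) (D.tail m) := .inl ⟨(m, false), by rw [hm]; rfl, rfl, rfl⟩
  exact ((reach_of_upperArcs h2).tail hs).trans (reach_of_upperArcs h1)

theorem Compat.not_badWalk_of_twoWay (h : D.Compat r φ) {x y : V(G)}
    (hxy : ReflTransGen (D.ArcRel {a | φ a.1 = .twoWay}) x y) : ¬ D.BadWalk r φ x y := by
  rintro ⟨m, hm, h1, h2⟩
  exact h.2 m hm ((h1.trans (arcRel_mono (twoWay_subset_upperArcs m) hxy)).trans h2)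

theorem Compat.not_badWalk_of_le (hr : Function.Injective r) (h : D.Compat r φ) {x y : V(G)}
    {m m' : E(G)} (hle : r m ≤ r m') (hm : φ m = .backward) (hm' : φ m' = .backward)
    (h1 : ReflTransGen (D.ArcRel (upperArcs r φ m)) (D.tail m) x)
    (h2 : ReflTransGen (D.ArcRel (upperArcs r φ m)) y (D.head m))
    (h3 : ReflTransGen (D.ArcRel (upperArcs r φ m')) (D.tail m') y)
    (h4 : ReflTransGen (D.ArcRel (upperArcs r φ m')) x (D.head m')) : False := by
  have h3' := arcRel_mono (upperArcs_anti hle) h3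
  have h4' := arcRel_mono (upperArcs_anti hle) h4
  rcases hle.eq_or_lt with heq | hlt
  · obtain rfl := hr heq
    exact h.2 m hm (h1.trans h4)
  · have hs : D.ArcRel (upperArcs r φ m) (D.head m') (D.tail m') :=
      ⟨(m', false), .inr ⟨by rw [hm']; rfl, hlt⟩, rfl, rfl⟩
    exact h.2 m hm ((((h1.trans h4').tail hs).trans h3').trans h2)

/-- Bad walks in both directions between `x` and `y` concatenate to a closed walk; the lower-ranked
of their two backward edges then violates compatibility. -/
theorem Compat.not_badWalk_symm (hr : Function.Injective r) (h : D.Compat r φ) {x y : V(G)}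
    (hxy : D.BadWalk r φ x y) : ¬ D.BadWalk r φ y x := by
  obtain ⟨m, hm, h1, h2⟩ := hxy
  rintro ⟨m', hm', h3, h4⟩
  rcases le_total (r m) (r m') with hle | hle
  · exact h.not_badWalk_of_le hr hle hm hm' h1 h2 h3 h4
  · exact h.not_badWalk_of_le hr hle hm' hm h3 h4 h1 h2

variable [DecidableEq E(G)]

theorem reflTransGen_twoWayArcs_update (c : Config) {m : E(G)} (hm : m ≠ e)
    (u v : V(G)) :
    ReflTransGen (D.ArcRel (twoWayArcs (Function.update φ e c) m)) u v ↔
      ReflTransGen (D.ArcRel (twoWayArcs (Function.update φ e .zeroWay) m)) u v ∨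
      (c = .twoWay ∧
        ReflTransGen (D.ArcRel (twoWayArcs (Function.update φ e .zeroWay) m)) u (D.tail e) ∧
        ReflTransGen (D.ArcRel (twoWayArcs (Function.update φ e .zeroWay) m)) (D.head e) v) ∨
      (c = .twoWay ∧
        ReflTransGen (D.ArcRel (twoWayArcs (Function.update φ e .zeroWay) m)) u (D.head e) ∧
        ReflTransGen (D.ArcRel (twoWayArcs (Function.update φ e .zeroWay) m)) (D.tail e) v) := by
  refine reflTransGen_add_edge (fun u v => ?_) u v
  refine arcRel_add_edge ?_ ?_ ?_ ?_ u v
  · intro a ha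
    simp [twoWayArcs, ha]
  · simp [twoWayArcs]
  · simp [twoWayArcs, hm.symm]
  · simp [twoWayArcs, hm.symm]

theorem reflTransGen_upperArcs_update (c : Config) {m : E(G)} (hm : r m < r e)
    (u v : V(G)) :
    ReflTransGen (D.ArcRel (upperArcs r (Function.update φ e c) m)) u v ↔
      ReflTransGen (D.ArcRel (upperArcs r (Function.update φ e .zeroWay) m)) u v ∨
      (c.Allows true ∧
        ReflTransGen (D.ArcRel (upperArcs r (Function.update φ e .zeroWay) m)) u (D.tail e) ∧
        ReflTransGen (D.ArcRel (upperArcs r (Function.update φ e .zeroWay) m)) (D.head e) v) ∨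
      (c.Allows false ∧
        ReflTransGen (D.ArcRel (upperArcs r (Function.update φ e .zeroWay) m)) u (D.head e) ∧
        ReflTransGen (D.ArcRel (upperArcs r (Function.update φ e .zeroWay) m)) (D.tail e) v) := by
  refine reflTransGen_add_edge (fun u v => ?_) u v
  refine arcRel_add_edge ?_ ?_ ?_ ?_ u v
  · intro a ha
    simp [upperArcs, ha]
  · simp [upperArcs, Config.Allows]
  · cases c <;> simp [upperArcs, hm, Config.Allows]
  · cases c <;> simp [upperArcs, hm, Config.Allows]

theorem twoWayArcs_update_self (c : Config) : twoWayArcs (Function.update φ e c) e =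
    {a | Function.update φ e Config.zeroWay a.1 = .twoWay} := by
  ext ⟨a, d⟩
  by_cases ha : a = e
  · subst ha
    simp [twoWayArcs]
  · simp [twoWayArcs, ha]

/-- No edge is ranked above `e`, so only 2-way edges can contribute. -/
theorem upperArcs_update_self (hr : ∀ m, m ≠ e → r m < r e) {c : Config} (hc : c ≠ .twoWay) :
    upperArcs r (Function.update φ e c) e =
      {a | Function.update φ e Config.zeroWay a.1 = .twoWay} := by
  ext ⟨a, d⟩
  by_cases ha : a = e
  · subst ha
    simp [upperArcs, hc]
  · simp [upperArcs, ha, (hr a ha).not_gt]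

theorem Compat.update_zeroWay (hr : ∀ m, m ≠ e → r m < r e) {c : Config}
    (h : D.Compat r (Function.update φ e c)) : D.Compat r (Function.update φ e .zeroWay) := by
  constructor
  · intro m hm hreach
    have hme : m ≠ e := by
      rintro rfl
      simp at hm
    refine h.1 m (by simpa [hme] using hm) ?_
    rw [reflTransGen_twoWayArcs_update c hme]
    exact .inl hreach
  · intro m hm hreach
    have hme : m ≠ e := by
      rintro rfl
      simp at hm
    refine h.2 m (by simpa [hme] using hm) ?_
    rw [reflTransGen_upperArcs_update c (hr m hme)]
    exact .inl hreach

/-- Since `e` has the largest rank, it is the least 1-way edge of a cycle only if all other edges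
there are 2-way; this is the first condition, which also excludes 2-way cycles through `e`. In any
other bad cycle through `e` the least edge lies elsewhere, and removing `e` leaves a bad walk
between its ends. -/
theorem compat_update_iff (hr : ∀ m, m ≠ e → r m < r e)
    (hz : D.Compat r (Function.update φ e .zeroWay)) (c : Config) :
    D.Compat r (Function.update φ e c) ↔
      ((c = .twoWay ∨ c = .backward) →
        ¬ ReflTransGen (D.ArcRel {a | Function.update φ e Config.zeroWay a.1 = .twoWay})
          (D.tail e) (D.head e)) ∧
      (c.Allows true → ¬ D.BadWalk r (Function.update φ e .zeroWay) (D.tail e) (D.head e)) ∧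
      (c.Allows false → ¬ D.BadWalk r (Function.update φ e .zeroWay) (D.head e) (D.tail e)) := by
  constructor
  · intro h
    refine ⟨?_, ?_, ?_⟩
    · rintro (rfl | rfl) hreach
      · exact h.1 e (by simp) (by rwa [twoWayArcs_update_self])
      · exact h.2 e (by simp) (by rwa [upperArcs_update_self hr (by simp)])
    · rintro hc ⟨m, hm, h1, h2⟩
      have hme : m ≠ e := by
        rintro rfl
        simp at hm
      refine h.2 m (by simpa [hme] using hm) ?_
      rw [reflTransGen_upperArcs_update c (hr m hme)]
      exact .inr (.inl ⟨hc, h1, h2⟩)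
    · rintro hc ⟨m, hm, h1, h2⟩
      have hme : m ≠ e := by
        rintro rfl
        simp at hm
      refine h.2 m (by simpa [hme] using hm) ?_
      rw [reflTransGen_upperArcs_update c (hr m hme)]
      exact .inr (.inr ⟨hc, h1, h2⟩)
  · rintro ⟨h0, h1, h2⟩
    constructor
    · intro m hm hreach
      by_cases hme : m = e
      · subst hme
        rw [twoWayArcs_update_self] at hreach
        exact h0 (.inl (by simpa using hm)) hreach
      have hm' : Function.update φ e .zeroWay m = .twoWay := by simpa [hme] using hm
      rw [reflTransGen_twoWayArcs_update c hme] at hreach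
      have hsub : ∀ {u v}, ReflTransGen
          (D.ArcRel (twoWayArcs (Function.update φ e .zeroWay) m)) u v →
          ReflTransGen (D.ArcRel {a | Function.update φ e Config.zeroWay a.1 = .twoWay}) u v :=
        fun h => arcRel_mono (fun a ha => ha.1) h
      have hsymm : ∀ {u v},
          ReflTransGen (D.ArcRel {a | Function.update φ e Config.zeroWay a.1 = .twoWay}) u v →
          ReflTransGen (D.ArcRel {a | Function.update φ e Config.zeroWay a.1 = .twoWay}) v u :=
        fun h => reflTransGen_arcRel_symm (fun _ _ h => h) h
      have hs : ReflTransGen (D.ArcRel {a | Function.update φ e Config.zeroWay a.1 = .twoWay})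
          (D.tail m) (D.head m) := .single ⟨(m, true), hm', rfl, rfl⟩
      -- If the 2-way walk uses `e`, its two remaining pieces and `m`, reversed where necessary,
      -- join the ends of `e` through other 2-way edges.
      rcases hreach with hreach | ⟨rfl, h3, h4⟩ | ⟨rfl, h3, h4⟩
      · exact hz.1 m hm' hreach
      · exact h0 (.inl rfl) (((hsymm (hsub h3)).trans hs).trans (hsymm (hsub h4)))
      · exact h0 (.inl rfl) (((hsub h4).trans (hsymm hs)).trans (hsub h3))
    · intro m hm hreach
      by_cases hme : m = e
      · subst hme
        have hc : c = .backward := by simpa using hm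
        subst hc
        rw [upperArcs_update_self hr (by simp)] at hreach
        exact h0 (.inr rfl) hreach
      have hm' : Function.update φ e .zeroWay m = .backward := by simpa [hme] using hm
      rw [reflTransGen_upperArcs_update c (hr m hme)] at hreach
      rcases hreach with hreach | ⟨hc, h3, h4⟩ | ⟨hc, h3, h4⟩
      · exact hz.2 m hm' hreach
      · exact h1 hc ⟨m, hm', h3, h4⟩
      · exact h2 hc ⟨m, hm', h3, h4⟩

/-- Each obstruction to compatibility comes with reachability between the ends of `e`, in just the
direction for which the validity pairing matches the configurations that remain compatible. Without
an obstruction, compatibility does not depend on `e`. -/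
theorem exists_pairs_valid_compat {A B A' B' : Set (V(G) × V(G))} (hAB : A ∪ B ⊆ A' ∪ B')
    (hinj : Function.Injective r) (hr : ∀ m, m ≠ e → r m < r e) (φ : Fourientation G) :
    ∃ b, Pairs (fun c => (D.Valid A B (Function.update φ e c) ∧
      D.Valid A' B' (Function.update φ e c)) ∧ D.Compat r (Function.update φ e c)) b := by
  by_cases hz : D.Compat r (Function.update φ e .zeroWay)
  swap
  · have : ∀ c, ¬ D.Compat r (Function.update φ e c) := fun c hc => hz (hc.update_zeroWay hr)
    exact ⟨true, by simp only [Pairs, this, and_false, and_self]⟩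
  have key := compat_update_iff hr hz
  have hf := key .forward
  have hb := key .backward
  have ht := key .twoWay
  simp only [Config.Allows, reduceCtorEq, or_false, or_true, or_self,
    forall_const, IsEmpty.forall_iff, true_and, and_true] at hf hb ht
  by_cases h0 : ReflTransGen
      (D.ArcRel {a | Function.update φ e Config.zeroWay a.1 = .twoWay}) (D.tail e) (D.head e)
  · have h1 := hz.not_badWalk_of_twoWay h0
    have h2 : ∀ A B, D.Reach A B (Function.update φ e .zeroWay) (D.tail e) (D.head e) :=
      fun A B => reach_of_upperArcs (arcRel_mono (twoWay_subset_upperArcs (r := r) e) h0)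
    exact ⟨true, by simp [Pairs, hz, hf, hb, ht, h0, h1, valid_update_of_reach (h2 _ _)]⟩
  by_cases h1 : D.BadWalk r (Function.update φ e .zeroWay) (D.tail e) (D.head e)
  · have h2 := hz.not_badWalk_symm hinj h1
    exact ⟨false, by simp [Pairs, hz, hf, hb, ht, h0, h1, h2, valid_update_of_reach_symm h1.reach]⟩
  by_cases h2 : D.BadWalk r (Function.update φ e .zeroWay) (D.head e) (D.tail e)
  · exact ⟨true, by simp [Pairs, hz, hf, hb, ht, h0, h1, h2, valid_update_of_reach h2.reach]⟩
  obtain ⟨b, hp⟩ := exists_pairs_valid (D := D) hAB φ e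
  refine ⟨b, ?_⟩
  cases b <;> simpa only [Pairs, hz, hf, hb, ht, h0, h1, h2, not_false_eq_true, and_true] using hp

end ToggleCompat

end RefOrientation

/-! ### Counting fourientations with a given set of solid edges -/

/-- The involution exchanging the 1-way and the solid configurations according to a pairing. -/
def Config.toggle : Bool → Config → Config
  | true, .forward => .zeroWay
  | true, .zeroWay => .forward
  | true, .backward => .twoWay
  | true, .twoWay => .backward
  | false, .forward => .twoWay
  | false, .twoWay => .forward
  | false, .backward => .zeroWay
  | false, .zeroWay => .backward

theorem Config.toggle_toggle (b : Bool) (c : Config) : (c.toggle b).toggle b = c := by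
  cases b <;> cases c <;> rfl

theorem Config.toggle_solid (b : Bool) (c : Config) :
    (c.toggle b = .zeroWay ∨ c.toggle b = .twoWay) ↔ ¬ (c = .zeroWay ∨ c = .twoWay) := by
  cases b <;> cases c <;> simp [Config.toggle]

/-- A property of fourientations which pairs the configurations at `e` holds as often with `e`
1-way as with `e` solid. -/
theorem ncard_solid_insert [DecidableEq E(G)] {P : Fourientation G → Prop} {e : E(G)}
    (hP : ∀ φ, ∃ b, RefOrientation.Pairs (fun c => P (Function.update φ e c)) b)
    {S : Set E(G)} (he : e ∉ S) :
    {φ | solid φ = S ∧ P φ}.ncard = {φ | solid φ = insert e S ∧ P φ}.ncard := by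
  choose b hb using hP
  -- The pairing is read off after making `e` 0-way, so it is the same for `φ` and `T φ`, and `T` is
  -- an involution.
  let T : Fourientation G → Fourientation G := fun φ =>
    Function.update φ e ((φ e).toggle (b (Function.update φ e .zeroWay)))
  have hTT : ∀ φ, T (T φ) = φ := by
    intro φ
    simp [T, Config.toggle_toggle]
  have hTP : ∀ φ, P (T φ) ↔ P φ := by
    intro φ
    have h := hb (Function.update φ e .zeroWay)
    have hφ : P φ ↔ P (Function.update φ e (φ e)) := by rw [Function.update_eq_self]
    rw [hφ]
    simp only [T]
    generalize b (Function.update φ e .zeroWay) = b' at h ⊢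
    generalize φ e = c
    cases b' <;> cases c <;> simp only [RefOrientation.Pairs, Function.update_idem,
      Config.toggle] at h ⊢ <;> tauto
  have hmem : ∀ φ, e ∈ solid (T φ) ↔ e ∉ solid φ := by
    intro φ
    simpa [solid, T] using Config.toggle_solid (b (Function.update φ e .zeroWay)) (φ e)
  have hmem' : ∀ φ e', e' ≠ e → (e' ∈ solid (T φ) ↔ e' ∈ solid φ) := by
    intro φ e' h
    simp [solid, T, h]
  refine Set.ncard_congr (fun φ _ => T φ) ?_ ?_ ?_
  · rintro φ ⟨rfl, hφ⟩
    refine ⟨?_, (hTP φ).2 hφ⟩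
    ext e'
    by_cases h : e' = e
    · subst h
      simp [hmem, he]
    · simp [hmem' φ e' h, h]
  · intro φ ψ _ _ h
    rw [← hTT φ, h, hTT]
  · rintro φ ⟨hS, hφ⟩
    refine ⟨T φ, ⟨?_, (hTP φ).2 hφ⟩, hTT φ⟩
    ext e'
    by_cases h : e' = e
    · subst h
      simp [hmem, he, hS]
    · simp [hmem' φ e' h, h, hS]

/-! ### Reversals -/

@[simp] theorem Config.reverse_reverse (c : Config) : c.reverse.reverse = c := by
  cases c <;> rfl

@[simp] theorem Config.reverse_eq_twoWay {c : Config} : c.reverse = .twoWay ↔ c = .twoWay := by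
  cases c <;> simp [Config.reverse]

@[simp] theorem Config.reverse_eq_zeroWay {c : Config} :
    c.reverse = .zeroWay ↔ c = .zeroWay := by
  cases c <;> simp [Config.reverse]

@[simp] theorem Config.allows_reverse {c : Config} {d : Bool} :
    c.reverse.Allows d ↔ c.Allows (!d) := by
  cases c <;> cases d <;> simp [Config.reverse, Config.Allows]

theorem reverseOn_of_mem {F : Set E(G)} {φ : Fourientation G} {e : E(G)} (h : e ∈ F) :
    reverseOn F φ e = (φ e).reverse := if_pos h

theorem reverseOn_of_notMem {F : Set E(G)} {φ : Fourientation G} {e : E(G)} (h : e ∉ F) :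
    reverseOn F φ e = φ e := if_neg h

theorem reverseOn_reverseOn (F : Set E(G)) (φ : Fourientation G) :
    reverseOn F (reverseOn F φ) = φ := by
  ext e
  by_cases h : e ∈ F
  · simp [reverseOn_of_mem h]
  · simp [reverseOn_of_notMem h]

theorem reverseOn_eq_twoWay {F : Set E(G)} {φ : Fourientation G} {e : E(G)} :
    reverseOn F φ e = .twoWay ↔ φ e = .twoWay := by
  by_cases h : e ∈ F
  · simp [reverseOn_of_mem h]
  · simp [reverseOn_of_notMem h]

theorem reverseOn_eq_zeroWay {F : Set E(G)} {φ : Fourientation G} {e : E(G)} :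
    reverseOn F φ e = .zeroWay ↔ φ e = .zeroWay := by
  by_cases h : e ∈ F
  · simp [reverseOn_of_mem h]
  · simp [reverseOn_of_notMem h]

namespace RefOrientation

variable {D : RefOrientation G} {A B : Set (V(G) × V(G))} {φ ψ : Fourientation G}

theorem src_not (a : Arc G) : D.src (a.1, !a.2) = D.tgt a := by
  obtain ⟨e, d⟩ := a
  cases d <;> rfl

theorem tgt_not (a : Arc G) : D.tgt (a.1, !a.2) = D.src a := by
  obtain ⟨e, d⟩ := a
  cases d <;> rfl

theorem eq_or_eq_not {a b : Arc G} (h : a.1 = b.1) : a = b ∨ a = (b.1, !b.2) := by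
  obtain ⟨e, d⟩ := a
  obtain ⟨e', d'⟩ := b
  obtain rfl : e = e' := h
  cases d <;> cases d' <;> simp

/-! #### Directed cycles -/

theorem CycleStep.symm (h : D.CycleStep φ ψ) : D.CycleStep ψ φ := by
  obtain ⟨k, c, hc, hφ, rfl⟩ := h
  have hrange : (Set.range fun i => (c (-i)).1) = Set.range fun i => (c i).1 :=
    (Equiv.neg (Fin (k + 1))).surjective.range_comp fun i => (c i).1
  refine ⟨k, fun i => ((c (-i)).1, !(c (-i)).2), ⟨?_, ?_, ?_⟩, ?_, ?_⟩
  · intro i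
    rw [tgt_not, src_not, hc.closed]
    congr 2
    abel
  · intro i j hij
    simp only [src_not, hc.closed] at hij
    simpa using hc.vertices hij
  · intro i j hij
    simpa using hc.edges hij
  · intro i
    simp only
    rw [reverseOn_of_mem (Set.mem_range_self (f := fun i => (c i).1) (-i)),
      Config.allows_reverse, Bool.not_not]
    exact hφ _
  · simp only [hrange, reverseOn_reverseOn]

open Fin.NatCast Fin.CommRing in
theorem reflTransGen_of_cyclic {V : Type*} {r : V → V → Prop} {k : ℕ} {s : Fin (k + 1) → V}
    (h : ∀ i, r (s i) (s (i + 1))) (i j : Fin (k + 1)) : ReflTransGen r (s i) (s j) := by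
  have key : ∀ n : ℕ, ReflTransGen r (s i) (s (i + (n : Fin (k + 1)))) := by
    intro n
    induction n with
    | zero => simpa using ReflTransGen.refl
    | succ n ih =>
      refine ih.tail ?_
      have := h (i + (n : Fin (k + 1)))
      rwa [add_assoc, ← Nat.cast_succ] at this
  have := key (j - i).val
  simpa using this

/-- The vertices of a directed cycle reach each other, so a reversed arc can be replaced by going
around the cycle. -/
theorem CycleStep.reach (h : D.CycleStep φ ψ) {u v : V(G)} (huv : D.Reach A B ψ u v) :
    D.Reach A B φ u v := by
  obtain ⟨k, c, hc, hφ, rfl⟩ := h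
  have hcyc : ∀ i j, D.Reach A B φ (D.src (c i)) (D.src (c j)) :=
    reflTransGen_of_cyclic (fun i => .inl ⟨c i, hφ i, rfl, hc.closed i⟩)
  induction huv with
  | refl => exact .refl
  | tail _ hs ih =>
    rcases hs with ⟨a, ha, rfl, rfl⟩ | hs
    · by_cases hmem : a.1 ∈ Set.range fun i => (c i).1
      · obtain ⟨i, hi⟩ := hmem
        rcases eq_or_eq_not (a := a) (b := c i) hi.symm with rfl | rfl
        · exact ih.tail (.inl ⟨c i, hφ i, rfl, rfl⟩)
        · refine ih.trans ?_
          rw [src_not, tgt_not, hc.closed]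
          exact hcyc _ _
      · rw [reverseOn_of_notMem hmem] at ha
        exact ih.tail (.inl ⟨a, ha, rfl, rfl⟩)
    · exact ih.tail (.inr hs)

theorem CycleStep.reach_iff (h : D.CycleStep φ ψ) {u v : V(G)} :
    D.Reach A B ψ u v ↔ D.Reach A B φ u v :=
  ⟨h.reach, h.symm.reach⟩

theorem CycleStep.valid_iff (h : D.CycleStep φ ψ) : D.Valid A B ψ ↔ D.Valid A B φ := by
  simp only [Valid, h.reach_iff]

/-! #### Directed cocycles -/

theorem CocycleStep.symm (h : D.CocycleStep A B φ ψ) : D.CocycleStep A B ψ φ := by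
  obtain ⟨U, ⟨hne, hAB⟩, hφ, rfl⟩ := h
  have hcut : D.cut Uᶜ = D.cut U := by
    ext e
    simp [cut, not_iff_not]
  refine ⟨Uᶜ, ⟨by rwa [hcut], ?_⟩, ?_, ?_⟩
  · intro u v huv
    simp [hAB u v huv]
  · intro a ha hs ht
    simp only [Set.mem_compl_iff, not_not] at hs ht
    have hmem : a.1 ∈ D.cut U := by
      obtain ⟨e, d⟩ := a
      cases d <;> simp_all [cut]
    rw [reverseOn_of_mem hmem, Config.allows_reverse] at ha
    refine hφ (a.1, !a.2) ha ?_ ?_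
    · rwa [src_not]
    · rwa [tgt_not]
  · rw [hcut, reverseOn_reverseOn]

theorem mem_cut_iff {U : Set V(G)} (a : Arc G) :
    a.1 ∈ D.cut U ↔ ¬ (D.src a ∈ U ↔ D.tgt a ∈ U) := by
  obtain ⟨e, d⟩ := a
  cases d <;> simp [cut, iff_comm]

/-- A walk that leaves `U` cannot return. Its ends lie on the same side because `(u, v)` does not
cross the cut, so it never meets a reversed edge. -/
theorem CocycleStep.reach (h : D.CocycleStep A B φ ψ) {u v : V(G)} (huv : (u, v) ∈ A ∪ B)
    (hr : D.Reach A B φ v u) : D.Reach A B ψ v u := by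
  obtain ⟨U, ⟨-, hAB⟩, hφ, rfl⟩ := h
  have hstep : ∀ b c, D.Adj A B φ b c → b ∉ U → c ∉ U := by
    rintro b c (⟨a, ha, rfl, rfl⟩ | hbc) hb
    · exact hφ a ha hb
    · rwa [← hAB b c hbc]
  have hpath : ∀ {b c}, D.Reach A B φ b c → b ∉ U → c ∉ U := by
    intro b c hbc hb
    induction hbc with
    | refl => exact hb
    | tail _ hs ih => exact hstep _ _ hs ih
  have hiff := (hAB u v huv).symm
  clear huv
  induction hr using ReflTransGen.head_induction_on with
  | refl => exact .refl
  | head hs hr ih =>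
    rename_i b c
    have hbc : b ∈ U ↔ c ∈ U := by
      constructor
      · intro hb
        by_contra hc
        exact hpath hr hc (hiff.1 hb)
      · intro hc
        by_contra hb
        exact hstep _ _ hs hb hc
    refine .head ?_ (ih (hbc.symm.trans hiff))
    rcases hs with ⟨a, ha, rfl, rfl⟩ | hs
    · refine .inl ⟨a, ?_, rfl, rfl⟩
      rwa [reverseOn_of_notMem]
      rw [mem_cut_iff]
      exact not_not.2 hbc
    · exact .inr hs

theorem CocycleStep.valid (h : D.CocycleStep A B φ ψ) (hv : D.Valid A B φ) :
    D.Valid A B ψ :=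
  ⟨fun u v huv hr => hv.1 u v huv (h.symm.reach (.inl huv) hr),
    fun u v huv => h.reach (.inr huv) (hv.2 u v huv)⟩

/-! #### Invariance of the solid edges -/

/-- `φ` and `ψ` have the same 2-way edges and the same 0-way edges. -/
def SameSolid (φ ψ : Fourientation G) : Prop :=
  (∀ e, ψ e = .twoWay ↔ φ e = .twoWay) ∧ ∀ e, ψ e = .zeroWay ↔ φ e = .zeroWay

theorem sameSolid_reverseOn (F : Set E(G)) (φ : Fourientation G) :
    SameSolid φ (reverseOn F φ) :=
  ⟨fun _ => reverseOn_eq_twoWay, fun _ => reverseOn_eq_zeroWay⟩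

theorem CycleStep.sameSolid (h : D.CycleStep φ ψ) : SameSolid φ ψ := by
  obtain ⟨_, _, _, _, rfl⟩ := h
  exact sameSolid_reverseOn _ _

theorem CocycleStep.sameSolid (h : D.CocycleStep A B φ ψ) : SameSolid φ ψ := by
  obtain ⟨_, _, _, rfl⟩ := h
  exact sameSolid_reverseOn _ _

theorem SameSolid.solid_eq (h : SameSolid φ ψ) : solid ψ = solid φ := by
  simp only [solid, h.1, h.2]

theorem SameSolid.hasTwoWayCycle_iff (h : SameSolid φ ψ) :
    D.HasTwoWayCycle ψ ↔ D.HasTwoWayCycle φ := by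
  simp only [HasTwoWayCycle, h.1]

theorem SameSolid.hasZeroWayCocycle_iff (h : SameSolid φ ψ) :
    D.HasZeroWayCocycle A B ψ ↔ D.HasZeroWayCocycle A B φ := by
  simp only [HasZeroWayCocycle, h.2]

theorem CycleStep.mem_four (h : D.CycleStep φ ψ) {S : Set E(G)} (hφ : φ ∈ D.four A B S) :
    ψ ∈ D.four A B S :=
  ⟨h.valid_iff.2 hφ.1, h.sameSolid.solid_eq.trans hφ.2⟩

theorem CocycleStep.mem_four (h : D.CocycleStep A B φ ψ) {S : Set E(G)}
    (hφ : φ ∈ D.four A B S) : ψ ∈ D.four A B S :=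
  ⟨h.valid hφ.1, h.sameSolid.solid_eq.trans hφ.2⟩

/-! ### Simple paths and cycles -/

/-- A walk through arcs in `T` from the end of an arc `a` to its beginning can be closed to a
cycle by `a`. -/
theorem exists_isCycle_of_reflTransGen {T : Set (Arc G)} {a : Arc G} (ha : ∀ b ∈ T, b.1 ≠ a.1)
    (h : ReflTransGen (D.ArcRel T) (D.tgt a) (D.src a)) :
    ∃ (k : ℕ) (c : Fin (k + 1) → Arc G), D.IsCycle c ∧ (∃ i, c i = a) ∧
      ∀ i, c i = a ∨ c i ∈ T := by
  classical
  have hex : ∃ n : ℕ, ∃ (v : ℕ → V(G)) (s : ℕ → Arc G), v 0 = D.tgt a ∧ v n = D.src a ∧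
      ∀ i < n, s i ∈ T ∧ D.src (s i) = v i ∧ D.tgt (s i) = v (i + 1) := by
    generalize D.src a = x at h
    induction h with
    | refl => exact ⟨0, fun _ => D.tgt a, fun _ => a, rfl, rfl, by simp⟩
    | tail _ hs ih =>
      obtain ⟨n, v, s, h0, hn, hi⟩ := ih
      obtain ⟨b, hb, h1, h2⟩ := hs
      refine ⟨n + 1, Function.update v (n + 1) (D.tgt b), Function.update s n b, ?_, ?_, ?_⟩
      · rw [Function.update_of_ne (by omega), h0]
      · rw [Function.update_self, h2]
      · intro i hin
        rw [Function.update_of_ne (show i ≠ n + 1 by omega)]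
        by_cases hin' : i = n
        · subst hin'
          simp only [Function.update_self]
          exact ⟨hb, h1.trans hn.symm, trivial⟩
        · rw [Function.update_of_ne hin', Function.update_of_ne (by omega)]
          exact hi i (by omega)
  obtain ⟨v, s, h0, hn, hs⟩ := Nat.find_spec hex
  set n := Nat.find hex with hn_def
  -- A repeated vertex would allow the segment from `i` to `j` to be removed, contradicting the
  -- minimality of `n`.
  have hinj : ∀ i j, i < j → j ≤ n → v i ≠ v j := by
    intro i j hij hjn hv
    refine Nat.find_min hex (m := n - (j - i)) (by omega)
      ⟨fun l => if l ≤ i then v l else v (l + (j - i)),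
        fun l => if l < i then s l else s (l + (j - i)), ?_, ?_, ?_⟩
    · simpa using h0
    · simp only
      split_ifs with hle
      · have : n - (j - i) = i := by omega
        rw [this, hv, ← hn]
        congr 1
        omega
      · rw [← hn]
        congr 1
        omega
    · intro l hl
      rcases lt_trichotomy l i with hli | rfl | hli
      · simp only [hli, hli.le, Nat.succ_le_of_lt hli, if_true]
        exact hs l (by omega)
      · have h1 : l + (j - l) = j := by omega
        have h2 : l + 1 + (j - l) = j + 1 := by omega
        simp only [lt_irrefl, le_refl, if_true, if_false, h1, h2, hv, Nat.not_succ_le_self]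
        exact hs j (by omega)
      · have h1 : l + 1 + (j - i) = l + (j - i) + 1 := by omega
        simp only [hli.not_gt, hli.not_ge, show ¬ l + 1 ≤ i by omega, if_false, h1]
        exact hs (l + (j - i)) (by omega)
  have hinj' : ∀ i j, i ≤ n → j ≤ n → v i = v j → i = j := by
    intro i j hi hj hv
    rcases lt_trichotomy i j with h | h | h
    · exact absurd hv (hinj i j h hj)
    · exact h
    · exact absurd hv.symm (hinj j i h hi)
  have hsrc : ∀ i : Fin (n + 1), D.src (if (i : ℕ) < n then s i else a) = v i := by
    intro i
    split_ifs with hi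
    · exact (hs i hi).2.1
    · have : (i : ℕ) = n := by omega
      rw [this, hn]
  refine ⟨n, fun i => if (i : ℕ) < n then s i else a, ⟨?_, ?_, ?_⟩, ⟨Fin.last n, by simp⟩, ?_⟩
  · intro i
    rw [hsrc]
    split_ifs with hi
    · rw [(hs i hi).2.2, Fin.val_add_one_of_lt (by simpa [Fin.lt_def] using hi)]
    · have : i = Fin.last n := Fin.ext (by simp; omega)
      rw [this, Fin.last_add_one]
      simpa using h0.symm
  · intro i j hij
    simp only [hsrc] at hij
    exact Fin.ext (hinj' _ _ (by omega) (by omega) hij)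
  · intro i j hij
    simp only at hij
    split_ifs at hij with hi hj hj
    · rcases eq_or_eq_not hij with h | h
      · have := (hs i hi).2.1
        rw [h, (hs j hj).2.1] at this
        exact Fin.ext (hinj' _ _ (by omega) (by omega) this.symm)
      -- Opposite traversals of one edge would force both `i = j + 1` and `j = i + 1`.
      · have h1 := (hs i hi).2.1
        have h2 := (hs i hi).2.2
        rw [h, src_not, (hs j hj).2.2] at h1
        rw [h, tgt_not, (hs j hj).2.1] at h2
        have h3 := hinj' _ _ (by omega) (by omega) h1
        have h4 := hinj' _ _ (by omega) (by omega) h2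
        omega
    · exact absurd hij (ha _ (hs i hi).1)
    · exact absurd hij.symm (ha _ (hs j hj).1)
    · exact Fin.ext (by omega)
  · intro i
    simp only
    split_ifs with hi
    · exact .inr (hs i hi).1
    · exact .inl rfl

theorem hasTwoWayCycle_of_reflTransGen {m : E(G)} (hm : φ m = .twoWay)
    (h : ReflTransGen (D.ArcRel (twoWayArcs φ m)) (D.tail m) (D.head m)) :
    D.HasTwoWayCycle φ := by
  obtain ⟨k, c, hc, -, hT⟩ := exists_isCycle_of_reflTransGen (a := (m, false))
    (fun b hb => hb.2) h
  refine ⟨k, c, hc, fun i => ?_⟩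
  rcases hT i with h | h
  · rwa [h]
  · exact h.1

open Fin.NatCast Fin.CommRing in
theorem HasTwoWayCycle.exists_reflTransGen (h : D.HasTwoWayCycle φ) :
    ∃ m, φ m = .twoWay ∧
      ReflTransGen (D.ArcRel (twoWayArcs φ m)) (D.tail m) (D.head m) := by
  obtain ⟨k, c, hc, hφ⟩ := h
  refine ⟨(c 0).1, hφ 0, ?_⟩
  have key : ∀ n : ℕ, n ≤ k → ReflTransGen (D.ArcRel (twoWayArcs φ (c 0).1)) (D.tgt (c 0))
      (D.tgt (c (n : Fin (k + 1)))) := by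
    intro n
    induction n with
    | zero =>
      intro _
      rw [Nat.cast_zero]
    | succ n ih =>
      intro hn
      refine (ih (by omega)).tail ⟨c ((n + 1 : ℕ) : Fin (k + 1)), ⟨hφ _, ?_⟩, ?_, rfl⟩
      · intro h
        have h1 := congrArg Fin.val (hc.edges h)
        rw [Fin.val_natCast, Nat.mod_eq_of_lt (by omega)] at h1
        simp at h1
      · rw [hc.closed, Nat.cast_succ]
  have h1 := key k le_rfl
  rw [hc.closed (k : Fin (k + 1)), Fin.natCast_eq_last, Fin.last_add_one] at h1
  rcases hd : (c 0).2 with _ | _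
  · have : c 0 = ((c 0).1, false) := by rw [← hd]
    rwa [this] at h1
  · have : c 0 = ((c 0).1, true) := by rw [← hd]
    rw [this] at h1
    exact reflTransGen_arcRel_symm (twoWayArcs_symm _ _) h1

end RefOrientation

/-! ### Invariants of the reversal classes -/

instance : Finite Config :=
  Finite.of_injective (β := Fin 4)
    (fun | .zeroWay => 0 | .forward => 1 | .backward => 2 | .twoWay => 3)
    (by intro a b h; cases a <;> cases b <;> simp_all)

/-- The sign of the direction of a 1-way edge; `0` for a solid edge. -/
def Config.sign : Config → ℤ
  | .zeroWay => 0
  | .forward => 1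
  | .backward => -1
  | .twoWay => 0

namespace RefOrientation

/-- The difference of a vertex potential along each edge. -/
def coboundary (D : RefOrientation G) (p : V(G) → ℤ) (e : E(G)) : ℤ := p (D.tail e) - p (D.head e)

/-- The difference along each edge of the indicator function of a set of vertices. -/
noncomputable def cutSign (D : RefOrientation G) (U : Set V(G)) (e : E(G)) : ℤ :=
  D.coboundary (U.indicator 1) e

/-- No 2-way edge of `φ` has exactly one end in `U`. -/
def TwoWayClosed (D : RefOrientation G) (φ : Fourientation G) (U : Set V(G)) : Prop :=
  ∀ e, φ e = .twoWay → (D.tail e ∈ U ↔ D.head e ∈ U)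

/-- `ψ` differs from `φ` by the reversals along the potential `p` and the flow `c`. -/
structure Differ [Fintype E(G)] (D : RefOrientation G) (A B : Set (V(G) × V(G)))
    (φ ψ : Fourientation G) (p : V(G) → ℤ) (c : E(G) → ℤ) : Prop where
  sameSolid : SameSolid φ ψ
  pair : ∀ u v, (u, v) ∈ A ∪ B → p u = p v
  twoWay : ∀ e, φ e = .twoWay → p (D.tail e) = p (D.head e)
  flux : ∀ U, D.TwoWayClosed φ U → ∑ e, c e * D.cutSign U e = 0
  sign_sub : ∀ e, (φ e).sign - (ψ e).sign = 2 * ((φ e).sign ^ 2 * D.coboundary p e) + c e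

variable {D : RefOrientation G} {A B : Set (V(G) × V(G))} {φ ψ χ : Fourientation G}

theorem SameSolid.sign_sq (h : SameSolid φ ψ) (e : E(G)) :
    (ψ e).sign ^ 2 = (φ e).sign ^ 2 := by
  have h1 := h.1 e
  have h2 := h.2 e
  cases hφ : φ e <;> cases hψ : ψ e <;> simp_all [Config.sign]

theorem SameSolid.symm (h : SameSolid φ ψ) : SameSolid ψ φ :=
  ⟨fun e => (h.1 e).symm, fun e => (h.2 e).symm⟩

theorem SameSolid.trans (h : SameSolid φ ψ) (h' : SameSolid ψ χ) : SameSolid φ χ :=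
  ⟨fun e => (h'.1 e).trans (h.1 e), fun e => (h'.2 e).trans (h.2 e)⟩

theorem SameSolid.eq_of_sign_eq (h : SameSolid φ ψ) {e : E(G)}
    (he : (φ e).sign = (ψ e).sign) : φ e = ψ e := by
  have h1 := h.1 e
  have h2 := h.2 e
  cases hφ : φ e <;> cases hψ : ψ e <;> simp_all [Config.sign]

theorem SameSolid.twoWayClosed_iff (h : SameSolid φ ψ) {U : Set V(G)} :
    D.TwoWayClosed ψ U ↔ D.TwoWayClosed φ U := by
  simp only [TwoWayClosed, h.1]

theorem cutSign_eq_zero {U : Set V(G)} {e : E(G)} (h : D.tail e ∈ U ↔ D.head e ∈ U) :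
    D.cutSign U e = 0 := by
  by_cases h' : D.head e ∈ U <;> simp_all [cutSign, coboundary]

theorem cutSign_eq_one {U : Set V(G)} {e : E(G)} (h : D.tail e ∈ U) (h' : D.head e ∉ U) :
    D.cutSign U e = 1 := by
  simp [cutSign, coboundary, h, h']

theorem cutSign_eq_neg_one {U : Set V(G)} {e : E(G)} (h : D.tail e ∉ U) (h' : D.head e ∈ U) :
    D.cutSign U e = -1 := by
  simp [cutSign, coboundary, h, h']

theorem sign_mul_cutSign {U : Set V(G)} (hU : D.TwoWayClosed φ U) {a : Arc G}
    (ha : (φ a.1).Allows a.2) :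
    (φ a.1).sign * D.cutSign U a.1 =
      U.indicator (1 : V(G) → ℤ) (D.src a) - U.indicator 1 (D.tgt a) := by
  obtain ⟨e, d⟩ := a
  cases d <;> cases hφ : φ e <;>
    simp_all [Config.sign, Config.Allows, cutSign, coboundary]
  all_goals
    have := hU e hφ
    by_cases h : D.head e ∈ U <;> simp_all

/-! ### Potentials and flows produced by reversals -/

section Differ

variable [Fintype E(G)] {p p' : V(G) → ℤ} {c c' : E(G) → ℤ}

theorem Differ.refl (φ : Fourientation G) : D.Differ A B φ φ 0 0 where
  sameSolid := ⟨fun _ => Iff.rfl, fun _ => Iff.rfl⟩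
  pair _ _ _ := rfl
  twoWay _ _ := rfl
  flux _ _ := by simp
  sign_sub _ := by simp [coboundary]

theorem Differ.trans (h : D.Differ A B φ ψ p c) (h' : D.Differ A B ψ χ p' c') :
    D.Differ A B φ χ (p + p') (c + c') where
  sameSolid := h.sameSolid.trans h'.sameSolid
  pair u v huv := by simp [h.pair u v huv, h'.pair u v huv]
  twoWay e he := by simp [h.twoWay e he, h'.twoWay e ((h.sameSolid.1 e).2 he)]
  flux U hU := by
    simp [add_mul, Finset.sum_add_distrib, h.flux U hU,
      h'.flux U (h.sameSolid.twoWayClosed_iff.2 hU)]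
  sign_sub e := by
    have h1 := h.sign_sub e
    have h2 := h'.sign_sub e
    rw [h.sameSolid.sign_sq] at h2
    simp only [coboundary, Pi.add_apply] at *
    linear_combination h1 + h2

theorem Differ.symm (h : D.Differ A B φ ψ p c) : D.Differ A B ψ φ (-p) (-c) where
  sameSolid := h.sameSolid.symm
  pair u v huv := by simp [h.pair u v huv]
  twoWay e he := by simp [h.twoWay e ((h.sameSolid.1 e).1 he)]
  flux U hU := by simp [h.flux U (h.sameSolid.twoWayClosed_iff.1 hU)]
  sign_sub e := by
    have h1 := h.sign_sub e
    rw [h.sameSolid.sign_sq]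
    simp only [coboundary, Pi.neg_apply] at *
    linear_combination -h1

/-- The flux of a reversed cycle telescopes. Its 2-way edges carry no sign, which is why only cuts
not crossed by 2-way edges are tested. -/
theorem CycleStep.exists_differ (h : D.CycleStep φ ψ) : ∃ c, D.Differ A B φ ψ 0 c := by
  have hs := h.sameSolid
  obtain ⟨k, s, hs', hφ, rfl⟩ := h
  refine ⟨fun e => (φ e).sign - (reverseOn (Set.range fun i => (s i).1) φ e).sign, hs,
    fun _ _ _ => rfl, fun _ _ => rfl, fun U hU => ?_, fun e => by simp [coboundary]⟩
  classical
  have h1 : ∀ e, ((φ e).sign - (reverseOn (Set.range fun i => (s i).1) φ e).sign) *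
      D.cutSign U e = if e ∈ Finset.univ.image (fun i => (s i).1) then
        2 * ((φ e).sign * D.cutSign U e) else 0 := by
    intro e
    have h2 : e ∈ Finset.univ.image (fun i => (s i).1) ↔ e ∈ Set.range fun i => (s i).1 := by
      simp
    split_ifs with he
    · rw [reverseOn_of_mem (h2.1 he)]
      cases φ e <;> simp [Config.sign, Config.reverse]
    · rw [reverseOn_of_notMem (fun h => he (h2.2 h))]
      simp
  rw [Finset.sum_congr rfl fun e _ => h1 e, Finset.sum_ite_mem, Finset.univ_inter,
    Finset.sum_image fun i _ j _ hij => hs'.edges hij, ← Finset.mul_sum,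
    Finset.sum_congr rfl fun i _ => sign_mul_cutSign hU (hφ i), Finset.sum_sub_distrib]
  simp only [hs'.closed]
  have h3 := Equiv.sum_comp (Equiv.addRight (1 : Fin (k + 1)))
    fun i => U.indicator (1 : V(G) → ℤ) (D.src (s i))
  simp only [Equiv.coe_addRight] at h3
  rw [h3, sub_self, mul_zero]

theorem CocycleStep.exists_differ (h : D.CocycleStep A B φ ψ) :
    ∃ p, D.Differ A B φ ψ p 0 := by
  have hs := h.sameSolid
  obtain ⟨U, ⟨-, hAB⟩, hφ, rfl⟩ := h
  have htwo : ∀ e, φ e = .twoWay → (D.tail e ∈ U ↔ D.head e ∈ U) := by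
    intro e he
    have h1 := hφ (e, true) (by rw [he]; trivial)
    have h2 := hφ (e, false) (by rw [he]; trivial)
    simp only [src_true, tgt_true, src_false, tgt_false] at h1 h2
    tauto
  -- All 1-way edges of the cut point out of `U`, so the indicator of `U` is the potential that
  -- reverses them.
  refine ⟨U.indicator 1, hs, ?_, ?_, by simp, ?_⟩
  · intro u v huv
    have := hAB u v huv
    by_cases hv : v ∈ U <;> simp_all
  · intro e he
    have := htwo e he
    by_cases hv : D.head e ∈ U <;> simp_all
  · intro e
    change _ = 2 * ((φ e).sign ^ 2 * D.cutSign U e) + 0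
    by_cases he : e ∈ D.cut U
    · rw [reverseOn_of_mem he]
      have he' : ¬ (D.tail e ∈ U ↔ D.head e ∈ U) := he
      cases hc : φ e
      · simp [Config.reverse, Config.sign]
      · have h1 := hφ (e, true) (by rw [hc]; rfl)
        simp only [src_true, tgt_true] at h1
        rw [cutSign_eq_one (by tauto) (by tauto)]
        simp [Config.reverse, Config.sign]
      · have h1 := hφ (e, false) (by rw [hc]; rfl)
        simp only [src_false, tgt_false] at h1
        rw [cutSign_eq_neg_one (by tauto) (by tauto)]
        simp [Config.reverse, Config.sign]
      · simp [Config.reverse, Config.sign]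
    · rw [reverseOn_of_notMem he, cutSign_eq_zero (not_not.1 he)]
      simp

theorem CycleEquiv.exists_differ (h : D.CycleEquiv φ ψ) : ∃ c, D.Differ A B φ ψ 0 c := by
  induction h with
  | refl => exact ⟨0, .refl _⟩
  | tail _ hs ih =>
    obtain ⟨c, hc⟩ := ih
    obtain ⟨c', hc'⟩ := hs.exists_differ (A := A) (B := B)
    exact ⟨_, by simpa using hc.trans hc'⟩

theorem CocycleEquiv.exists_differ (h : D.CocycleEquiv A B φ ψ) :
    ∃ p, D.Differ A B φ ψ p 0 := by
  induction h with
  | refl => exact ⟨0, .refl _⟩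
  | tail _ hs ih =>
    obtain ⟨c, hc⟩ := ih
    obtain ⟨c', hc'⟩ := hs.exists_differ
    exact ⟨_, by simpa using hc.trans hc'⟩

theorem CycleCocycleEquiv.exists_differ (h : D.CycleCocycleEquiv A B φ ψ) :
    ∃ p c, D.Differ A B φ ψ p c := by
  induction h with
  | refl => exact ⟨0, 0, .refl _⟩
  | tail _ hs ih =>
    obtain ⟨p, c, hc⟩ := ih
    rcases hs with hs | hs
    · obtain ⟨c', hd⟩ := hs.exists_differ (A := A) (B := B)
      exact ⟨_, _, hc.trans hd⟩
    · obtain ⟨p', hd⟩ := hs.exists_differ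
      exact ⟨_, _, hc.trans hd⟩

/-! ### Compatible representatives -/

variable {r : E(G) → ℕ}

/-- If two fourientations differ by a flow, the differing edge of least rank cannot have its
unconventional direction in a compatible fourientation. -/
theorem Compat.not_backward_of_flux (hr : Function.Injective r) (hsame : SameSolid φ ψ)
    (hflux : ∀ U, D.TwoWayClosed φ U → ∑ e, ((φ e).sign - (ψ e).sign) * D.cutSign U e = 0)
    (hφ : D.Compat r φ) {m : E(G)} (hm : φ m ≠ ψ m) (hmin : ∀ e, φ e ≠ ψ e → r m ≤ r e) :
    φ m ≠ .backward := by
  intro hmb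
  -- Every differing edge across the cut of `U` enters `U` in `φ`: those above `m` because `U` is
  -- closed under `T`, and `m` because it is backward. All terms of the flux are then non-positive,
  -- and that of `m` is negative.
  let T : Set (Arc G) := {a | a ∈ upperArcs r φ m ∧ (φ a.1 = .twoWay ∨ φ a.1 ≠ ψ a.1)}
  let U : Set V(G) := {v | ReflTransGen (D.ArcRel T) (D.tail m) v}
  have htail : D.tail m ∈ U := ReflTransGen.refl
  have hhead : D.head m ∉ U := fun h => hφ.2 m hmb (arcRel_mono (fun _ ha => ha.1) h)
  have hclosed : ∀ a ∈ T, D.src a ∈ U → D.tgt a ∈ U := fun a ha hs =>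
    ReflTransGen.tail hs ⟨a, ha, rfl, rfl⟩
  have hU : D.TwoWayClosed φ U := fun e he =>
    ⟨hclosed (e, true) ⟨.inl he, .inl he⟩, hclosed (e, false) ⟨.inl he, .inl he⟩⟩
  have hopp : ∀ e, φ e ≠ ψ e → (φ e).sign - (ψ e).sign = 2 * (φ e).sign := by
    intro e he
    have h1 := hsame.1 e
    have h2 := hsame.2 e
    cases h : φ e <;> cases h' : ψ e <;> simp_all [Config.sign]
  refine (Finset.sum_neg' (fun e _ => ?_) ⟨m, Finset.mem_univ m, ?_⟩).ne (hflux U hU)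
  · by_cases he : φ e = ψ e
    · simp [he]
    rw [hopp e he]
    have harc : ∀ d, (φ e).Allows d → e ≠ m → (e, d) ∈ T := fun d hd hem =>
      ⟨.inr ⟨hd, lt_of_le_of_ne (hmin e he) fun h => hem (hr h).symm⟩, .inr he⟩
    by_cases hcut : D.tail e ∈ U ↔ D.head e ∈ U
    · simp [cutSign_eq_zero hcut]
    cases hc : φ e
    · simp [Config.sign]
    · have h1 := hclosed _ (harc true (by rw [hc]; rfl) (by rintro rfl; simp [hmb] at hc))
      simp only [src_true, tgt_true] at h1
      rw [cutSign_eq_neg_one (by tauto) (by tauto)]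
      simp [Config.sign]
    · have h1 : D.head e ∈ U → D.tail e ∈ U := by
        by_cases hem : e = m
        · subst hem
          exact fun _ => htail
        · exact hclosed _ (harc false (by rw [hc]; rfl) hem)
      rw [cutSign_eq_one (by tauto) (by tauto)]
      simp [Config.sign]
    · simp [Config.sign]
  · rw [hopp m hm, cutSign_eq_one htail hhead, hmb]
    simp [Config.sign]

theorem Compat.eq_of_flux (hr : Function.Injective r) (hsame : SameSolid φ ψ)
    (hflux : ∀ U, D.TwoWayClosed φ U → ∑ e, ((φ e).sign - (ψ e).sign) * D.cutSign U e = 0)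
    (hφ : D.Compat r φ) (hψ : D.Compat r ψ) : φ = ψ := by
  by_contra hne
  obtain ⟨m, hm, hmin⟩ := Set.exists_min_image {e | φ e ≠ ψ e} r (Set.toFinite _)
    (Function.ne_iff.1 hne)
  have h1 := hφ.not_backward_of_flux hr hsame hflux hm hmin
  have h2 := hψ.not_backward_of_flux hr hsame.symm (fun U hU => by
    rw [← neg_eq_zero, ← Finset.sum_neg_distrib, ← hflux U (hsame.twoWayClosed_iff.1 hU)]
    exact Finset.sum_congr rfl fun e _ => by ring) (Ne.symm hm) fun e he => hmin e (Ne.symm he)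
  have h3 := hsame.1 m
  have h4 := hsame.2 m
  have hm' : φ m ≠ ψ m := hm
  cases h : φ m <;> cases h' : ψ m <;> simp_all

theorem exists_cycleEquiv_compat (hr : Function.Injective r) (hφ : ¬ D.HasTwoWayCycle φ) :
    ∃ ψ, D.CycleEquiv φ ψ ∧ D.Compat r ψ := by
  let _ : LinearOrder E(G) := LinearOrder.lift' r hr
  -- Take the lexicographically largest sign vector, edges of low rank first. Reversing a bad cycle
  -- turns its least 1-way edge from -1 to 1 and changes no sign of lower rank.
  obtain ⟨ψ, hψ, hmax⟩ := Set.exists_max_image {ψ | D.CycleEquiv φ ψ}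
    (fun ψ => toLex fun e => (ψ e).sign) (Set.toFinite _) ⟨φ, ReflTransGen.refl⟩
  refine ⟨ψ, hψ, fun m hm h => ?_, fun m hm h => ?_⟩
  · obtain ⟨c, hc⟩ := CycleEquiv.exists_differ (A := ∅) (B := ∅) hψ
    exact hφ (hc.sameSolid.hasTwoWayCycle_iff.1 (hasTwoWayCycle_of_reflTransGen hm h))
  · have hne : ∀ b ∈ upperArcs r ψ m, b.1 ≠ m := by
      rintro b (hb | hb) rfl
      · simp [hm] at hb
      · exact hb.2.false
    obtain ⟨k, c, hc, ⟨i, hi⟩, hT⟩ := exists_isCycle_of_reflTransGen (a := (m, false)) hne h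
    have hallow : ∀ i, (ψ (c i).1).Allows (c i).2 := by
      intro i
      rcases hT i with h | h | h
      · rw [h, hm]
        rfl
      · rw [h]
        trivial
      · exact h.1
    refine (hmax (reverseOn (Set.range fun i => (c i).1) ψ)
      (ReflTransGen.tail hψ ⟨k, c, hc, hallow, rfl⟩)).not_gt ⟨m, fun e he => ?_, ?_⟩
    · have he' : r e < r m := he
      by_cases hmem : e ∈ Set.range fun i => (c i).1
      · obtain ⟨j, rfl⟩ := hmem
        rcases hT j with h | h | h
        · simp [h] at he'
        · have h2 : reverseOn (Set.range fun i => (c i).1) ψ (c j).1 = .twoWay :=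
            reverseOn_eq_twoWay.2 h
          simp only [Pi.toLex_apply, h, h2]
        · exact absurd h.2 he'.not_gt
      · simp only [Pi.toLex_apply, reverseOn_of_notMem hmem]
    · have hmem : m ∈ Set.range fun i => (c i).1 := ⟨i, by simp [hi]⟩
      simp only [Pi.toLex_apply, reverseOn_of_mem hmem, hm]
      simp [Config.reverse, Config.sign]

end Differ

theorem Compat.not_hasTwoWayCycle {r : E(G) → ℕ} (h : D.Compat r φ) : ¬ D.HasTwoWayCycle φ :=
  fun h' =>
    let ⟨m, hm, hm'⟩ := h'.exists_reflTransGen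
    h.1 m hm hm'

end RefOrientation

/-! ### Rooted representatives -/

namespace RefOrientation

/-- `q` chooses a root in each connected component of the graph with the pairs in `A ∪ B`
added. -/
structure IsRootMap (D : RefOrientation G) (A B : Set (V(G) × V(G))) (q : V(G) → V(G)) :
    Prop where
  edge : ∀ e, q (D.tail e) = q (D.head e)
  pair : ∀ u v, (u, v) ∈ A ∪ B → q u = q v
  idem : ∀ v, q (q v) = q v
  conn : ∀ U : Set V(G), (∀ e, D.tail e ∈ U ↔ D.head e ∈ U) →
    (∀ u v, (u, v) ∈ A ∪ B → (u ∈ U ↔ v ∈ U)) → ∀ v, q v ∈ U ↔ v ∈ U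

theorem exists_isRootMap (D : RefOrientation G) (A B : Set (V(G) × V(G))) :
    ∃ q, D.IsRootMap A B q := by
  let R : V(G) → V(G) → Prop := fun u v =>
    (∃ e, D.tail e = u ∧ D.head e = v) ∨ (u, v) ∈ A ∪ B
  have hout : ∀ v, Relation.EqvGen R (Quot.out (Quot.mk R v)) v := fun v =>
    Quot.eqvGen_exact (Quot.out_eq (Quot.mk R v))
  refine ⟨fun v => Quot.out (Quot.mk R v), ?_, ?_, ?_, ?_⟩
  · intro e
    exact congrArg Quot.out (Quot.sound (.inl ⟨e, rfl, rfl⟩))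
  · intro u v huv
    exact congrArg Quot.out (Quot.sound (.inr huv))
  · intro v
    exact congrArg Quot.out (Quot.out_eq _)
  · intro U hE hAB v
    have key : ∀ {u v}, Relation.EqvGen R u v → (u ∈ U ↔ v ∈ U) := by
      intro u v h
      induction h with
      | rel u v h =>
        rcases h with ⟨e, rfl, rfl⟩ | h
        · exact hE e
        · exact hAB u v h
      | refl => exact Iff.rfl
      | symm _ _ _ ih => exact ih.symm
      | trans _ _ _ _ _ ih ih' => exact ih.trans ih'
    exact key (hout v)

/-- The pairs in `A ∪ B` in both directions, together with all pairs of a vertex and its root. -/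
def rootArcs (A B : Set (V(G) × V(G))) (q : V(G) → V(G)) : Set (V(G) × V(G)) :=
  {x | x ∈ A ∪ B ∨ x.swap ∈ A ∪ B ∨ x.2 = q x.1}

/-- Each vertex can be reached from its root, where pairs in `A ∪ B` may be used in both
directions. -/
def Rooted (D : RefOrientation G) (A B : Set (V(G) × V(G))) (q : V(G) → V(G))
    (φ : Fourientation G) : Prop :=
  D.Valid ∅ (rootArcs A B q) φ

variable {D : RefOrientation G} {A B : Set (V(G) × V(G))} {φ ψ : Fourientation G}
  {q : V(G) → V(G)}

/-- Pairs of `A ∪ B` and their swaps impose nothing, since the reversed arc is itself in `rootArcs`;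
only the pairs of a vertex and its root matter. -/
theorem rooted_iff : D.Rooted A B q φ ↔ ∀ v, D.Reach ∅ (rootArcs A B q) φ (q v) v := by
  constructor
  · exact fun h v => h.2 v (q v) (.inr (.inr rfl))
  · refine fun h => ⟨fun _ _ h => absurd h (Set.notMem_empty _), fun u v huv => ?_⟩
    rcases huv with huv | huv | huv
    · exact .single (.inr (.inr (.inr (.inl huv))))
    · exact .single (.inr (.inr (.inl huv)))
    · obtain rfl : v = q u := huv
      exact h u

/-- In a rooted fourientation some arc enters each set of non-roots respected by `A ∪ B`. -/
theorem Rooted.notMem_of_no_entry (h : D.Rooted A B q φ) {W : Set V(G)} (hq : ∀ v, q v ∉ W)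
    (hAB : ∀ u v, (u, v) ∈ A ∪ B → (u ∈ W ↔ v ∈ W))
    (harc : ∀ a : Arc G, (φ a.1).Allows a.2 → D.tgt a ∈ W → D.src a ∈ W) (v : V(G)) :
    v ∉ W := by
  have key : ∀ u v, D.Reach ∅ (rootArcs A B q) φ u v → u ∉ W → v ∉ W := by
    intro u v huv hu
    induction huv with
    | refl => exact hu
    | tail _ hs ih =>
      rename_i b c _
      rcases hs with ⟨a, ha, rfl, rfl⟩ | hs | hs | hs | hs
      · exact fun ht => ih (harc a ha ht)
      · exact absurd hs (Set.notMem_empty _)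
      · rwa [← hAB b c hs]
      · rwa [hAB c b hs]
      · obtain rfl : c = q b := hs
        exact hq b
  exact key _ _ (rooted_iff.1 h v) (hq v)

theorem IsRootMap.arc (hq : D.IsRootMap A B q) (a : Arc G) : q (D.src a) = q (D.tgt a) := by
  obtain ⟨e, d⟩ := a
  cases d
  · exact (hq.edge e).symm
  · exact hq.edge e

theorem Rooted.not_hasZeroWayCocycle (hq : D.IsRootMap A B q) (h : D.Rooted A B q φ) :
    ¬ D.HasZeroWayCocycle A B φ := by
  rintro ⟨U, ⟨⟨e, he⟩, hAB⟩, hU⟩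
  -- The vertices separated from their root by `U` form a set that no arc enters. It is therefore
  -- empty, and no edge crosses the cut.
  have key := h.notMem_of_no_entry (W := {v | ¬ (v ∈ U ↔ q v ∈ U)}) (fun v => by simp [hq.idem])
    (fun u v huv => by simp [hAB u v huv, hq.pair u v huv]) (fun a ha => by
      have hcut : a.1 ∉ D.cut U := fun hc => by
        rw [hU _ hc] at ha
        exact ha
      rw [mem_cut_iff, not_not] at hcut
      simp [hcut, hq.arc a])
  have h1 := key (D.tail e)
  have h2 := key (D.head e)
  simp only [Set.mem_ofPred_eq, not_not] at h1 h2
  rw [hq.edge e] at h1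
  exact he (h1.trans h2.symm)

theorem _root_.Fourient.Config.abs_sign_le (c : Config) : |c.sign| ≤ 1 := by
  cases c <;> simp [Config.sign]

theorem SameSolid.abs_sign_sub_le (h : SameSolid φ ψ) (e : E(G)) :
    |(φ e).sign - (ψ e).sign| ≤ 2 * (φ e).sign ^ 2 := by
  have h1 := h.1 e
  have h2 := h.2 e
  cases hφ : φ e <;> cases hψ : ψ e <;> simp_all [Config.sign]

/-- Maximum principle: let `W` be the set where `p v - p (q v)` attains a positive maximum. Across
its cut the potential drops by at least 1 outwards, so `2 * sign ^ 2 * coboundary` bounds the sign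
difference termwise, while zero flux forces equality of the sums. An arc of `φ` entering `W` would
make one term strict; with no such arc, rootedness leaves `W` empty. -/
theorem Differ.le_root [Fintype E(G)] [Finite V(G)] {p : V(G) → ℤ} {c : E(G) → ℤ}
    (h : D.Differ A B φ ψ p c) (hq : D.IsRootMap A B q) (hφ : D.Rooted A B q φ) (v : V(G)) :
    p v ≤ p (q v) := by
  by_contra! hv
  obtain ⟨w, -, hw⟩ := Set.exists_max_image Set.univ (fun v => p v - p (q v)) (Set.toFinite _)
    ⟨v, trivial⟩
  set M := p w - p (q w) with hM
  have hpos : 0 < M := (sub_pos.2 hv).trans_le (hw v trivial)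
  let W : Set V(G) := {v | p v - p (q v) = M}
  have hle : ∀ v, p v - p (q v) ≤ M := fun v => hw v trivial
  have hlt : ∀ v, v ∉ W → p v - p (q v) < M := fun v hv => lt_of_le_of_ne (hle v) hv
  have hAB : ∀ u v, (u, v) ∈ A ∪ B → (u ∈ W ↔ v ∈ W) := by
    intro u v huv
    simp only [W, Set.mem_ofPred_eq, h.pair u v huv, hq.pair u v huv]
  have hW : D.TwoWayClosed φ W := by
    intro e he
    simp only [W, Set.mem_ofPred_eq, h.twoWay e he, hq.edge e]
  have hout : ∀ e, D.tail e ∈ W → D.head e ∉ W → 1 ≤ D.coboundary p e := by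
    intro e h1 h2
    have h3 := hlt _ h2
    have h1' : p (D.tail e) - p (q (D.tail e)) = M := h1
    rw [hq.edge e] at h1'
    simp only [coboundary]
    omega
  have hin : ∀ e, D.tail e ∉ W → D.head e ∈ W → D.coboundary p e ≤ -1 := by
    intro e h1 h2
    have h3 := hlt _ h1
    have h2' : p (D.head e) - p (q (D.head e)) = M := h2
    rw [hq.edge e] at h3
    simp only [coboundary]
    omega
  have hsum : ∑ e, ((φ e).sign - (ψ e).sign) * D.cutSign W e =
      ∑ e, 2 * ((φ e).sign ^ 2 * D.coboundary p e) * D.cutSign W e := by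
    simp only [h.sign_sub, add_mul, Finset.sum_add_distrib, h.flux W hW, add_zero]
  have hterm : ∀ e, ((φ e).sign - (ψ e).sign) * D.cutSign W e ≤
      2 * ((φ e).sign ^ 2 * D.coboundary p e) * D.cutSign W e := by
    intro e
    by_cases hcut : D.tail e ∈ W ↔ D.head e ∈ W
    · simp [cutSign_eq_zero hcut]
    obtain ⟨hb1, hb2⟩ := abs_le.1 (h.sameSolid.abs_sign_sub_le e)
    have hsq := sq_nonneg (φ e).sign
    by_cases ht : D.tail e ∈ W
    · have hh : D.head e ∉ W := by tauto
      rw [cutSign_eq_one ht hh]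
      nlinarith [mul_le_mul_of_nonneg_left (hout e ht hh) hsq]
    · have hh : D.head e ∈ W := by tauto
      rw [cutSign_eq_neg_one ht hh]
      nlinarith [mul_le_mul_of_nonneg_left (hin e ht hh) hsq]
  refine hφ.notMem_of_no_entry (W := W) (fun v => ?_) hAB ?_ w rfl
  · simp only [W, Set.mem_ofPred_eq, hq.idem, sub_self]
    exact hpos.ne
  · rintro ⟨e, d⟩ ha ht
    by_contra hs
    refine (Finset.sum_lt_sum (fun e _ => hterm e) ⟨e, Finset.mem_univ e, ?_⟩).ne hsum
    obtain ⟨hb1, hb2⟩ := abs_le.1 (ψ e).abs_sign_le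
    cases d
    · simp only [src_false, tgt_false] at hs ht
      have hc : φ e = .backward := by
        have hcl := hW e
        cases hφe : φ e <;> simp_all [Config.Allows]
      have := hout e ht hs
      rw [cutSign_eq_one ht hs, hc, show Config.sign .backward = -1 from rfl]
      linarith
    · simp only [src_true, tgt_true] at hs ht
      have hc : φ e = .forward := by
        have hcl := hW e
        cases hφe : φ e <;> simp_all [Config.Allows]
      have := hin e hs ht
      rw [cutSign_eq_neg_one hs ht, hc, show Config.sign .forward = 1 from rfl]
      linarith

theorem Differ.coboundary_eq_zero [Fintype E(G)] [Finite V(G)] {p : V(G) → ℤ} {c : E(G) → ℤ}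
    (h : D.Differ A B φ ψ p c) (hq : D.IsRootMap A B q) (hφ : D.Rooted A B q φ)
    (hψ : D.Rooted A B q ψ) (e : E(G)) : D.coboundary p e = 0 := by
  have h1 : ∀ v, p v = p (q v) := by
    intro v
    refine (h.le_root hq hφ v).antisymm ?_
    simpa using h.symm.le_root hq hψ v
  rw [coboundary, h1, hq.edge, ← h1, sub_self]

/-- Take a member of the class with the most vertices reached from their roots. No arc leaves the
reached set `W`, so if `W` is not everything, its cut is directed; reversing it keeps `W` reached
and adds the source of an entering arc. -/
theorem exists_cocycleEquiv_rooted [Finite V(G)] [Fintype E(G)] (hq : D.IsRootMap A B q)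
    (hφ : ¬ D.HasZeroWayCocycle A B φ) : ∃ ψ, D.CocycleEquiv A B φ ψ ∧ D.Rooted A B q ψ := by
  obtain ⟨ψ, hψ, hmax⟩ := Set.exists_max_image {ψ | D.CocycleEquiv A B φ ψ}
    (fun ψ => {v | D.Reach ∅ (rootArcs A B q) ψ (q v) v}.ncard) (Set.toFinite _)
    ⟨φ, ReflTransGen.refl⟩
  refine ⟨ψ, hψ, ?_⟩
  by_contra hroot
  rw [rooted_iff, not_forall] at hroot
  obtain ⟨w, hw⟩ := hroot
  set W : Set V(G) := {v | D.Reach ∅ (rootArcs A B q) ψ (q v) v} with hWdef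
  have hqW : ∀ v, q v ∈ W := fun v => by
    rw [hWdef, Set.mem_ofPred_eq, hq.idem]
    exact .refl
  have hsub : ∀ u v, (u, v) ∈ A ∪ B → (u ∈ W ↔ v ∈ W) := by
    intro u v huv
    simp only [hWdef, Set.mem_ofPred_eq, hq.pair u v huv]
    exact ⟨fun h => h.tail (.inr (.inr (.inl huv))),
      fun h => h.tail (.inr (.inr (.inr (.inl huv))))⟩
  have harc : ∀ a : Arc G, (ψ a.1).Allows a.2 → D.src a ∈ W → D.tgt a ∈ W := by
    intro a ha hs
    simp only [hWdef, Set.mem_ofPred_eq] at hs ⊢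
    rw [← hq.arc a]
    exact hs.tail (.inl ⟨a, ha, rfl, rfl⟩)
  -- An empty cut would make `W` a union of components, which contains every vertex together with
  -- its root.
  have hne : (D.cut Wᶜ).Nonempty := by
    by_contra hempty
    refine hw ((hq.conn W (fun e => ?_) hsub w).1 (hqW w))
    by_contra he
    refine hempty ⟨e, ?_⟩
    simpa [cut, not_iff_not] using he
  have hcut : D.IsABCut A B Wᶜ := ⟨hne, fun u v huv => by simp [hsub u v huv]⟩
  have hzero : ¬ D.HasZeroWayCocycle A B ψ := by
    obtain ⟨p, hp⟩ := CocycleEquiv.exists_differ hψ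
    rwa [hp.sameSolid.hasZeroWayCocycle_iff]
  obtain ⟨e, he, hez⟩ : ∃ e ∈ D.cut Wᶜ, ψ e ≠ .zeroWay := by
    by_contra! hall
    exact hzero ⟨_, hcut, hall⟩
  set χ := reverseOn (D.cut Wᶜ) ψ with hχ
  have hstep : D.CocycleStep A B ψ χ := by
    refine ⟨Wᶜ, hcut, fun a ha hs => ?_, rfl⟩
    simp only [Set.mem_compl_iff, not_not] at hs ⊢
    exact harc a ha hs
  have hcutW : ∀ a : Arc G, a.1 ∈ D.cut Wᶜ ↔ ¬ (D.src a ∈ W ↔ D.tgt a ∈ W) := by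
    intro a
    rw [mem_cut_iff]
    simp [not_iff_not]
  have hreach : ∀ v u, D.Reach ∅ (rootArcs A B q) ψ (q v) u →
      D.Reach ∅ (rootArcs A B q) χ (q v) u ∧ q u = q v := by
    intro v u hu
    induction hu with
    | refl => exact ⟨.refl, hq.idem v⟩
    | tail hr hs ih =>
      rename_i b c
      obtain ⟨ih, hqb⟩ := ih
      rcases hs with ⟨a, ha, rfl, rfl⟩ | hs | hs
      · refine ⟨ih.tail (.inl ⟨a, ?_, rfl, rfl⟩), by rw [← hq.arc, hqb]⟩
        have hsW : D.src a ∈ W := by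
          rw [hWdef, Set.mem_ofPred_eq, hqb]
          exact hr
        rw [hχ, reverseOn_of_notMem]
        · exact ha
        · rw [hcutW, not_not]
          exact iff_of_true hsW (harc a ha hsW)
      · exact absurd hs (Set.notMem_empty _)
      · refine ⟨ih.tail (.inr (.inr hs)), ?_⟩
        rcases hs with hs | hs | hs
        · rw [← hq.pair b c hs, hqb]
        · rw [hq.pair c b hs, hqb]
        · obtain rfl : c = q b := hs
          rw [hq.idem, hqb]
  have hWsub : W ⊆ {v | D.Reach ∅ (rootArcs A B q) χ (q v) v} := fun v hv => (hreach v v hv).1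
  obtain ⟨a, rfl, ha⟩ : ∃ a : Arc G, a.1 = e ∧ (ψ a.1).Allows a.2 := by
    cases h : ψ e
    · exact absurd h hez
    · exact ⟨(e, true), rfl, by simp [h, Config.Allows]⟩
    · exact ⟨(e, false), rfl, by simp [h, Config.Allows]⟩
    · exact ⟨(e, true), rfl, by simp [h, Config.Allows]⟩
  have hiff := (hcutW a).1 he
  have hsrc : D.src a ∉ W := fun h => hiff (iff_of_true h (harc a ha h))
  have htgt : D.tgt a ∈ W := by tauto
  have hnew : D.src a ∈ {v | D.Reach ∅ (rootArcs A B q) χ (q v) v} := by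
    have h1 := hWsub htgt
    simp only [Set.mem_ofPred_eq] at h1 ⊢
    rw [hq.arc a]
    refine h1.tail (.inl ⟨(a.1, !a.2), ?_, src_not a, tgt_not a⟩)
    rw [hχ, reverseOn_of_mem he, Config.allows_reverse, Bool.not_not]
    exact ha
  have hlt := Set.ncard_lt_ncard (Set.ssubset_iff_of_subset hWsub |>.2 ⟨_, hnew, hsrc⟩)
    (Set.toFinite _)
  exact (hmax χ (ReflTransGen.tail hψ hstep)).not_gt hlt

/-! ### Counting classes by representatives -/

/-- If a property is respected by a symmetric relation, the classes with this property are
counted by a system of representatives. -/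
theorem ncard_classes_eq {X : Type*} {s : X → X → Prop} {Q R : X → Prop}
    (hsymm : ∀ x y, s x y → s y x) (hQ : ∀ x y, s x y → Q x → Q y)
    (hex : ∀ x, Q x → ∃ y, ReflTransGen s x y ∧ R y)
    (huniq : ∀ x y, ReflTransGen s x y → R x → R y → x = y) :
    {C : Set X | (∃ x, C = {y | ReflTransGen s x y}) ∧ ∀ x ∈ C, Q x}.ncard =
      {x | Q x ∧ R x}.ncard := by
  have hsymm' : ∀ {x y}, ReflTransGen s x y → ReflTransGen s y x := by
    intro x y h
    induction h with
    | refl => exact .refl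
    | tail _ h ih => exact ih.head (hsymm _ _ h)
  have hQ' : ∀ {x y}, ReflTransGen s x y → Q x → Q y := by
    intro x y h hx
    induction h with
    | refl => exact hx
    | tail _ h ih => exact hQ _ _ h ih
  rw [← Set.InjOn.ncard_image (f := fun x => {y | ReflTransGen s x y})]
  · congr 1
    ext C
    constructor
    · rintro ⟨⟨x, rfl⟩, hx⟩
      obtain ⟨y, hxy, hy⟩ := hex x (hx x ReflTransGen.refl)
      refine ⟨y, ⟨hx y hxy, hy⟩, ?_⟩
      ext z
      exact ⟨fun h => hxy.trans h, fun h => (hsymm' hxy).trans h⟩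
    · rintro ⟨x, ⟨hx, -⟩, rfl⟩
      exact ⟨⟨x, rfl⟩, fun y hy => hQ' hy hx⟩
  · rintro x ⟨-, hx⟩ y ⟨-, hy⟩ hxy
    refine huniq x y ?_ hx hy
    have h : y ∈ {z | ReflTransGen s y z} := ReflTransGen.refl
    exact (Set.ext_iff.1 hxy y).2 h

section Classes

variable [Fintype E(G)] {r : E(G) → ℕ}

/-- Validity is repeated to match the two validity conditions in `exists_pairs_valid_compat`. -/
theorem ncard_cycClasses (D : RefOrientation G) (A B : Set (V(G) × V(G)))
    (hr : Function.Injective r) (S : Set E(G)) :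
    (D.cycClasses A B S).ncard =
      {φ | solid φ = S ∧ ((D.Valid A B φ ∧ D.Valid A B φ) ∧ D.Compat r φ)}.ncard := by
  unfold cycClasses CycleEquiv
  rw [ncard_classes_eq (Q := fun φ => φ ∈ D.four A B S ∧ ¬ D.HasTwoWayCycle φ)
    (R := D.Compat r) (fun _ _ h => h.symm)
    (fun _ _ h hφ => ⟨h.mem_four hφ.1, h.sameSolid.hasTwoWayCycle_iff.not.2 hφ.2⟩)
    (fun _ hφ => exists_cycleEquiv_compat hr hφ.2)]
  · congr 1
    ext φ
    simp only [four, Set.mem_ofPred_eq]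
    have := Compat.not_hasTwoWayCycle (D := D) (r := r) (φ := φ)
    tauto
  · intro φ ψ h hφ hψ
    obtain ⟨c, hc⟩ := CycleEquiv.exists_differ (A := A) (B := B) h
    refine hφ.eq_of_flux hr hc.sameSolid (fun U hU => ?_) hψ
    rw [← hc.flux U hU]
    simp [hc.sign_sub, coboundary]

theorem ncard_cocClasses [Finite V(G)] (hq : D.IsRootMap A B q) (S : Set E(G)) :
    (D.cocClasses A B S).ncard =
      {φ | solid φ = S ∧ (D.Valid A B φ ∧ D.Valid ∅ (rootArcs A B q) φ)}.ncard := by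
  unfold cocClasses CocycleEquiv
  rw [ncard_classes_eq (Q := fun φ => φ ∈ D.four A B S ∧ ¬ D.HasZeroWayCocycle A B φ)
    (R := D.Rooted A B q) (fun _ _ h => h.symm)
    (fun _ _ h hφ => ⟨h.mem_four hφ.1, h.sameSolid.hasZeroWayCocycle_iff.not.2 hφ.2⟩)
    (fun _ hφ => exists_cocycleEquiv_rooted hq hφ.2)]
  · congr 1
    ext φ
    simp only [four, Set.mem_ofPred_eq]
    have := Rooted.not_hasZeroWayCocycle (φ := φ) hq
    simp only [Rooted] at this ⊢
    tauto
  · intro φ ψ h hφ hψ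
    obtain ⟨p, hp⟩ := CocycleEquiv.exists_differ h
    funext e
    refine hp.sameSolid.eq_of_sign_eq (sub_eq_zero.1 ?_)
    simp [hp.sign_sub, hp.coboundary_eq_zero hq hφ hψ]

theorem ncard_ccClasses [Finite V(G)] (hq : D.IsRootMap A B q)
    (hr : Function.Injective r) (S : Set E(G)) :
    (D.ccClasses A B S).ncard = {φ | solid φ = S ∧
      ((D.Valid A B φ ∧ D.Valid ∅ (rootArcs A B q) φ) ∧ D.Compat r φ)}.ncard := by
  unfold ccClasses CycleCocycleEquiv
  rw [ncard_classes_eq (Q := fun φ => φ ∈ D.four A B S ∧ ¬ D.HasTwoWayCycle φ ∧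
    ¬ D.HasZeroWayCocycle A B φ) (R := fun φ => D.Rooted A B q φ ∧ D.Compat r φ)
    (fun _ _ h => h.imp (·.symm) (·.symm))]
  · congr 1
    ext φ
    simp only [four, Set.mem_ofPred_eq]
    have := Rooted.not_hasZeroWayCocycle (φ := φ) hq
    have := Compat.not_hasTwoWayCycle (D := D) (r := r) (φ := φ)
    simp only [Rooted] at *
    tauto
  · rintro φ ψ h ⟨hφ, h1, h2⟩
    have hs : SameSolid φ ψ := h.elim (·.sameSolid) (·.sameSolid)
    exact ⟨h.elim (·.mem_four hφ) (·.mem_four hφ), hs.hasTwoWayCycle_iff.not.2 h1,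
      hs.hasZeroWayCocycle_iff.not.2 h2⟩
  · rintro φ ⟨-, h1, h2⟩
    obtain ⟨ψ, hψ, hroot⟩ := exists_cocycleEquiv_rooted hq h2
    obtain ⟨p, hp⟩ := CocycleEquiv.exists_differ hψ
    obtain ⟨χ, hχ, hcompat⟩ :=
      exists_cycleEquiv_compat hr (hp.sameSolid.hasTwoWayCycle_iff.not.2 h1)
    -- Cocycles are reversed first: being rooted is a validity condition, so the later cycle
    -- reversals preserve it.
    refine ⟨χ, (ReflTransGen.mono (fun _ _ => .inr) _ _ hψ).trans
      (ReflTransGen.mono (fun _ _ => .inl) _ _ hχ), ?_, hcompat⟩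
    clear hcompat
    induction hχ with
    | refl => exact hroot
    | tail _ h ih => exact h.valid_iff.2 ih
  · rintro φ ψ h ⟨hφ, hφ'⟩ ⟨hψ, hψ'⟩
    obtain ⟨p, c, hc⟩ := CycleCocycleEquiv.exists_differ h
    -- Rootedness of both members kills the potential, and what remains is a pure flow.
    refine hφ'.eq_of_flux hr hc.sameSolid (fun U hU => ?_) hψ'
    rw [← hc.flux U hU]
    simp [hc.sign_sub, hc.coboundary_eq_zero hq hφ hψ]

end Classes

/-- The edges can be ranked such that a given edge has the largest rank. -/
theorem exists_rank_max {E : Type*} [Finite E] (e : E) :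
    ∃ r : E → ℕ, Function.Injective r ∧ ∀ m, m ≠ e → r m < r e := by
  classical
  obtain ⟨n, ⟨f⟩⟩ := Finite.exists_equiv_fin E
  refine ⟨fun m => if m = e then n else f m, fun a b hab => ?_, fun m hm => ?_⟩
  · have ha := (f a).isLt
    have hb := (f b).isLt
    simp only at hab
    split_ifs at hab with h1 h2 h2
    · rw [h1, h2]
    · omega
    · omega
    · exact f.injective (Fin.ext hab)
  · simp [hm]

theorem eq_of_eq_insert {E N : Type*} [Finite E] {f : Set E → N}
    (h : ∀ (e : E) (S : Set E), e ∉ S → f S = f (insert e S)) (S S' : Set E) : f S = f S' := by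
  have key : ∀ S : Set E, f S = f ∅ := fun S =>
    Set.Finite.induction_on (motive := fun S _ => f S = f ∅) S (Set.toFinite S) rfl
      fun {e S} he _ ih => (h e S he).symm.trans ih
  rw [key S, key S']

end RefOrientation

end Fourient

/-! ### Independence of the solid set -/

open Fourient RefOrientation in
theorem theorem4 {α β : Type*} (G : Graph α β) [Finite V(G)] [Finite E(G)]
    (D : Fourient.RefOrientation G) (A B : Set (V(G) × V(G))) :
    (∀ S S' : Set E(G), (D.cycClasses A B S).ncard = (D.cycClasses A B S').ncard) ∧
    (∀ S S' : Set E(G), (D.cocClasses A B S).ncard = (D.cocClasses A B S').ncard) ∧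
    (∀ S S' : Set E(G), (D.ccClasses A B S).ncard = (D.ccClasses A B S').ncard) := by
  classical
  have := Fintype.ofFinite E(G)
  obtain ⟨q, hq⟩ := exists_isRootMap D A B
  have hsub : A ∪ B ⊆ ∅ ∪ rootArcs A B q := fun _ h => .inr (.inl h)
  refine ⟨eq_of_eq_insert fun e S he => ?_, eq_of_eq_insert fun e S he => ?_,
    eq_of_eq_insert fun e S he => ?_⟩
  -- The ranking depends on the inserted edge `e`; both class counts are rewritten with the same
  -- one.
  · obtain ⟨r, hr, hmax⟩ := exists_rank_max e
    rw [ncard_cycClasses D A B hr, ncard_cycClasses D A B hr]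
    exact ncard_solid_insert (exists_pairs_valid_compat subset_rfl hr hmax) he
  · rw [ncard_cocClasses hq, ncard_cocClasses hq]
    exact ncard_solid_insert (fun φ => exists_pairs_valid hsub φ e) he
  · obtain ⟨r, hr, hmax⟩ := exists_rank_max e
    rw [ncard_ccClasses hq hr, ncard_ccClasses hq hr]
    exact ncard_solid_insert (exists_pairs_valid_compat hsub hr hmax) he
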